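/- Consider a 3D pendulum with symmetric positive definite body-fixed inertia matrix $J\in\mathbb{R}^{3\times 3}$, mass $m$, gravitational acceleration $g$ and body-fixed vector $\rho\in\mathbb{R}^3$ from the pivot to the centre of mass. Its configuration space is $SO(3)$; a tangent vector at $R$ is $R\hat\omega$ with $\omega\in\mathbb{R}^3$, where $\hat a b=a\times b$. Its Lagrangian is $L(R,\omega)=\frac12\omega\cdot J\omega+mg\,\rho\cdot R^Te_3$ with $e_3=(0,0,1)^T$, and its equations of motion are $\dot R=R\hat\omega$, $J\dot\omega=J\omega\times\omega+mg\,\rho\times R^Te_3$. The circle acts by $\Phi_\theta(R)=\exp(\theta\hat e_3)R$, with quotient map $\Pi:SO(3)\to S^2$, $\Pi(R)=\Gamma=R^Te_3$, for which $d\Pi(R\hat\omega)=\Gamma\times\omega$. Let $\mathbf J$ be the momentum map of this action (the vertical angular momentum), $\mathbb I$ the locked inertia tensor, $\mathcal A=\mathbb I^{-1}\mathbf J$ the mechanical connection and, for $\mu\in\mathbb{R}$, $\mathcal A_\mu=\mu\mathcal A$ (a one-form on $SO(3)$). Fix $\mu\in\mathbb{R}$. Then the restriction of $L-\mathcal A_\mu$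 to $\mathbf J^{-1}(\mu)$ descends, through $(R,\omega)\mapsto(\Gamma,\dot\Gamma)=(R^Te_3,\;R^Te_3\times\omega)$, to a unique function $R^\mu$ on $TS^2$ (the Routhian), $\mathbf d\mathcal A_\mu$ descends to a unique two-form $\beta_\mu$ on $S^2$ with $\Pi^*\beta_\mu=\mathbf d\mathcal A_\mu$ (the magnetic two-form), and the following hold, with $$b=\frac{J\Gamma\cdot(\dot\Gamma\times\Gamma)}{\Gamma\cdot J\Gamma},\qquad \nu=\frac{\mu}{\Gamma\cdot J\Gamma},\qquad c=\nu\Big\{\mathrm{tr}\,J-2\frac{\|J\Gamma\|^2}{\Gamma\cdot J\Gamma}\Big\}.$$ 1. For all $(\Gamma,\dot\Gamma)\in TS^2$, $$R^\mu(\Gamma,\dot\Gamma)=\tfrac12(\dot\Gamma\times\Gamma)\cdot J(\dot\Gamma\times\Gamma)-\tfrac12(b^2+\nu^2)(\Gamma\cdot J\Gamma)+mg\,\Gamma\cdot\rho.$$ 2. For all $\Gamma\in S^2$ and $\eta,\zeta\in\mathbb{R}^3$, $$\beta_\mu(\Gamma\times\eta,\Gamma\times\zeta)=-\frac{\mu}{(\Gamma\cdot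 J\Gamma)^2}\big[-(\Gamma\cdot J\Gamma)\,\mathrm{tr}\,J+2\|J\Gamma\|^2\big]\,\Gamma\cdot(\eta\times\zeta).$$ 3. Let $T>0$ and let $(R(t),\omega(t))$, $t\in[0,T]$, be a solution of the equations of motion with $\mathbf J(R(0),\omega(0))=\mu$. Then $\Gamma(t)=R(t)^Te_3$ is a $C^2$ curve on $S^2$ which satisfies the Euler--Lagrange variational equation with magnetic term $$\delta\int_0^T R^\mu(\Gamma,\dot\Gamma)\,dt=\int_0^T\mathbf i_{\dot\Gamma}\beta_\mu(\delta\Gamma)\,dt,\qquad(*)$$ that is, for every $C^2$ family $\Gamma_\varepsilon(t)$ of curves on $S^2$ with $\Gamma_0=\Gamma$ and fixed end points, and $\delta\Gamma=\partial_\varepsilon\Gamma_\varepsilon|_{\varepsilon=0}$, the derivative of $\varepsilon\mapsto\int_0^TR^\mu(\Gamma_\varepsilon,\dot\Gamma_\varepsilon)\,dt$ at $\varepsilon=0$ exists and equals $\int_0^T\beta_\mu(\dot\Gamma,\delta\Gamma)\,dt$. 4. For every $T>0$, a $C^2$ curve $\Gamma:[0,T]\to S^2$ satisfies $(*)$ if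 and only if, on $[0,T]$, it satisfies the reduced equation of motion on $TS^2$ $$\ddot\Gamma=-\|\dot\Gamma\|^2\Gamma+\Gamma\times\Sigma,$$ $$\Sigma=b\dot\Gamma+J^{-1}\big[(J(\dot\Gamma\times\Gamma)-bJ\Gamma)\times((\dot\Gamma\times\Gamma)-b\Gamma)+\nu^2J\Gamma\times\Gamma-mg\,\Gamma\times\rho-c\dot\Gamma\big].$$ -/

import Mathlib

open Set Matrix MeasureTheory
open scoped Topology

noncomputable section

namespace Pendulum

/-- Vectors of `ℝ³`; lengths and angles are expressed through the dot product `⬝ᵥ`, so `‖v‖²` is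
written `v ⬝ᵥ v`. -/
abbrev V3 : Type := Fin 3 → ℝ

/-- Real `3 × 3` matrices. -/
abbrev M3 : Type := Matrix (Fin 3) (Fin 3) ℝ

/-- Vertical unit vector (direction of gravity) of the inertial frame. -/
def e3 : V3 := ![0, 0, 1]

/-- The skew matrix `â`, with `â b = a × b`. -/
def hat (a : V3) : M3 :=
  !![0, -a 2, a 1; a 2, 0, -a 0; -a 1, a 0, 0]

/-- The inverse of `hat` on skew matrices. -/
def vee (A : M3) : V3 := ![A 2 1, A 0 2, A 1 0]

lemma vee_hat (a : V3) : vee (hat a) = a := by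
  ext i; fin_cases i <;> simp [vee, hat]

lemma hat_mulVec (a b : V3) : hat a *ᵥ b = a ⨯₃ b := by
  ext i; fin_cases i <;> simp [hat, cross_apply, mulVec, dotProduct, Fin.sum_univ_three] <;> ring

/-- The commutator of skew matrices is the cross product of vectors. -/
lemma hat_commutator (a b : V3) : hat a * hat b - hat b * hat a = hat (a ⨯₃ b) := by
  ext i j; fin_cases i <;> fin_cases j <;>
    simp [hat, cross_apply] <;> ring

/-- The rotation group `SO(3)`, as a set of matrices. -/
def SO3 : Set M3 := {R | R ∈ Matrix.specialOrthogonalGroup (Fin 3) ℝ}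

/-- The physical data of a 3D pendulum: the body-fixed inertia matrix `J` (symmetric positive
definite), mass `m`, gravitational acceleration `g`, and the body-fixed vector `ρ` from the pivot to
the centre of mass. -/
structure Data where
  J : M3
  J_posDef : J.PosDef
  m : ℝ
  g : ℝ
  ρ : V3

variable (P : Data)

/-! ### The pendulum on `T SO(3)`

A tangent vector `R ω̂` at `R ∈ SO(3)` is represented by the pair `(R, ω)`. -/

/-- The projection `Π : SO(3) → S²`, `Π(R) = Rᵀ e₃`. Its differential maps `(R, ω)` to
`Γ × ω` with `Γ = Π(R)`. -/
def proj (R : M3) : V3 := Rᵀ *ᵥ e3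

/-- The kinetic energy inner product at any `R`, in body coordinates. -/
def metric (ω η : V3) : ℝ := ω ⬝ᵥ (P.J *ᵥ η)

/-- The Lagrangian of the pendulum: kinetic energy minus the gravitational potential
`- m g ρ · Rᵀ e₃`. -/
def lagrangian (R : M3) (ω : V3) : ℝ :=
  (1 / 2) * metric P ω ω + P.m * P.g * (P.ρ ⬝ᵥ proj R)

/-- The symmetry action of `S¹` on `SO(3)` by rotations about the vertical axis,
`Φ_θ(R) = exp(θ ê₃) R`. -/
def action (θ : ℝ) (R : M3) : M3 := NormedSpace.exp (θ • hat e3) * R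

/-- The infinitesimal generator `d/dθ|₀ Φ_θ(R)` of the action (with the Lie algebra of `S¹`
identified with `ℝ`), in body coordinates. -/
def generator (R : M3) : V3 :=
  vee (Rᵀ * Matrix.of fun i j => deriv (fun θ : ℝ => action θ R i j) 0)

/-- The momentum map: the pairing of the momentum of `(R, ω)` with the generator. -/
def momentum (R : M3) (ω : V3) : ℝ := metric P ω (generator R)

/-- The locked inertia tensor. -/
def lockedInertia (R : M3) : ℝ := metric P (generator R) (generator R)

/-- The mechanical connection `𝒜 = 𝕀⁻¹ 𝐉`. -/
def connection (R : M3) (ω : V3) : ℝ := (lockedInertia P R)⁻¹ * momentum P R ω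

/-- The one-form `𝒜_μ = ⟨μ, 𝒜⟩` on `SO(3)`. -/
def connectionForm (μ : ℝ) (R : M3) (ω : V3) : ℝ := μ * connection P R ω

/-- The derivative `X[f]` at `R` of a function `f` on `SO(3)` along the left-invariant vector field
`X = R η̂`. -/
def leftDeriv (f : M3 → ℝ) (R : M3) (η : V3) : ℝ :=
  deriv (fun s : ℝ => f (R * NormedSpace.exp (s • hat η))) 0

/-- The exterior derivative of a one-form `α` on `SO(3)`,
`dα(X, Y) = X[α(Y)] - Y[α(X)] - α([X, Y])`, evaluated on the left-invariant vector fields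
`X = R η̂`, `Y = R ζ̂`, for which `[X, Y] = R (η × ζ)^`. -/
def extDerivOneForm (α : M3 → V3 → ℝ) (R : M3) (η ζ : V3) : ℝ :=
  leftDeriv (fun Q => α Q ζ) R η - leftDeriv (fun Q => α Q η) R ζ - α R (η ⨯₃ ζ)

/-- `R` and `ω` solve the full equations of motion on the time interval `[0, T]`:
`Ṙ = R ω̂` and `J ω̇ = J ω × ω + m g ρ × Rᵀ e₃`. -/
def IsMotion (T : ℝ) (R : ℝ → M3) (ω : ℝ → V3) : Prop :=
  ∀ t ∈ Icc 0 T,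
    R t ∈ SO3 ∧
    (∀ i j, HasDerivWithinAt (fun s => R s i j) ((R t * hat (ω t)) i j) (Icc 0 T) t) ∧
    ∃ ω' : V3, HasDerivWithinAt ω ω' (Icc 0 T) t ∧
      P.J *ᵥ ω' = (P.J *ᵥ ω t) ⨯₃ ω t + (P.m * P.g) • (P.ρ ⨯₃ proj (R t))

/-! ### Reduced objects on `TS²` -/

/-- `F` is the Routhian on `TS²` for the momentum value `μ`: the function induced on `TS²`, through
`(R, ω) ↦ (Γ, Γ × ω)` with `Γ = Rᵀ e₃`, by the restriction of `L - 𝒜_μ` to the level set `𝐉 = μ`. -/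
def IsRouthian (μ : ℝ) (F : V3 → V3 → ℝ) : Prop :=
  ∀ R ∈ SO3, ∀ ω : V3, momentum P R ω = μ →
    F (proj R) (proj R ⨯₃ ω) = lagrangian P R ω - connectionForm P μ R ω

/-- `β` is the magnetic two-form on `S²` for the momentum value `μ`: the two-form whose pullback
along `Π : SO(3) → S²` is `d𝒜_μ`. (Only the values of `β Γ` on `T_Γ S²`, for `Γ ∈ S²`, matter.) -/
def IsMagneticForm (μ : ℝ) (β : V3 → V3 [⋀^Fin 2]→ₗ[ℝ] ℝ) : Prop :=
  ∀ R ∈ SO3, ∀ η ζ : V3,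
    β (proj R) ![proj R ⨯₃ η, proj R ⨯₃ ζ] = extDerivOneForm (connectionForm P μ) R η ζ

/-- `Γ` is a `C²` curve on the unit sphere over `[0, T]`. -/
def IsSphereCurve (T : ℝ) (Γ : ℝ → V3) : Prop :=
  ContDiffOn ℝ 2 Γ (Icc 0 T) ∧ ∀ t ∈ Icc 0 T, Γ t ⬝ᵥ Γ t = 1

/-- Velocity of a curve on `[0, T]` (one-sided at the end points). -/
def velocity (T : ℝ) (Γ : ℝ → V3) (t : ℝ) : V3 := derivWithin Γ (Icc 0 T) t

/-- `G ε t = Γ_ε(t)` is a variation of `Γ` in `S²` over `[0, T]`: a `C²` family of curves on the unit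
sphere, with `Γ_0 = Γ` and fixed end points. -/
structure IsVariation (T : ℝ) (Γ : ℝ → V3) (G : ℝ → ℝ → V3) : Prop where
  contDiffOn : ContDiffOn ℝ 2 (fun p : ℝ × ℝ => G p.1 p.2) (univ ×ˢ Icc 0 T)
  unit : ∀ ε, ∀ t ∈ Icc 0 T, G ε t ⬝ᵥ G ε t = 1
  base : ∀ t ∈ Icc 0 T, G 0 t = Γ t
  left : ∀ ε, G ε 0 = Γ 0
  right : ∀ ε, G ε T = Γ T

/-- The variational equation `δ ∫₀ᵀ F(Γ, Γ̇) dt = ∫₀ᵀ i_Γ̇ β(δΓ) dt`: for all variations `Γ_ε` of `Γ`,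
with `δΓ = ∂Γ_ε/∂ε` at `ε = 0`, the function `ε ↦ ∫₀ᵀ F(Γ_ε, Γ̇_ε) dt` is differentiable at `0` with
the derivative `∫₀ᵀ β(Γ)(Γ̇, δΓ) dt`. -/
def SatisfiesVariationalEquation (F : V3 → V3 → ℝ) (β : V3 → V3 [⋀^Fin 2]→ₗ[ℝ] ℝ)
    (T : ℝ) (Γ : ℝ → V3) : Prop :=
  ∀ G : ℝ → ℝ → V3, IsVariation T Γ G →
    HasDerivAt (fun ε => ∫ t in (0 : ℝ)..T, F (G ε t) (velocity T (G ε) t))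
      (∫ t in (0 : ℝ)..T, β (Γ t) ![velocity T Γ t, deriv (fun ε => G ε t) 0]) 0

/-! ### The explicit coefficients -/

/-- `b = JΓ · (Γ̇ × Γ) / (Γ · JΓ)`. -/
def bCoeff (Γ Γ' : V3) : ℝ := ((P.J *ᵥ Γ) ⬝ᵥ (Γ' ⨯₃ Γ)) / (Γ ⬝ᵥ (P.J *ᵥ Γ))

/-- `ν = μ / (Γ · JΓ)`. -/
def nuCoeff (μ : ℝ) (Γ : V3) : ℝ := μ / (Γ ⬝ᵥ (P.J *ᵥ Γ))

/-- `c = ν (tr J - 2 ‖JΓ‖² / (Γ · JΓ))`. -/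
def cCoeff (μ : ℝ) (Γ : V3) : ℝ :=
  nuCoeff P μ Γ *
    (P.J.trace - 2 * (((P.J *ᵥ Γ) ⬝ᵥ (P.J *ᵥ Γ)) / (Γ ⬝ᵥ (P.J *ᵥ Γ))))

/-- `Σ = b Γ̇ + J⁻¹ [(J(Γ̇ × Γ) - b JΓ) × ((Γ̇ × Γ) - b Γ) + ν² JΓ × Γ - m g Γ × ρ - c Γ̇]`. -/
def sigmaVec (μ : ℝ) (Γ Γ' : V3) : V3 :=
  bCoeff P Γ Γ' • Γ' +
    P.J⁻¹ *ᵥ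
      ((P.J *ᵥ (Γ' ⨯₃ Γ) - bCoeff P Γ Γ' • (P.J *ᵥ Γ)) ⨯₃ ((Γ' ⨯₃ Γ) - bCoeff P Γ Γ' • Γ)
        + (nuCoeff P μ Γ) ^ 2 • ((P.J *ᵥ Γ) ⨯₃ Γ)
        - (P.m * P.g) • (Γ ⨯₃ P.ρ)
        - cCoeff P μ Γ • Γ')

end Pendulum

end

open Pendulum

/-!
The circle action on `SO(3)` has the generator `Γ = Rᵀ e₃` in body coordinates, so the momentum map is
`ω · J Γ` and the locked inertia is `Γ · J Γ`. Since every unit vector is `Rᵀ e₃` for some rotation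
`R`, and every tangent vector at it comes from an `ω` of momentum `μ`, the Routhian and the magnetic
form are determined on the sphere by their values upstairs (`isRouthian_routhian`,
`IsRouthian.eq_routhian`, `IsMagneticForm.apply_tangent`). The magnetic form is `c` times the area
form; this rests on `J u × v + u × J v = (tr J - J) (u × v)` (`J_cross_add_cross_J`).

With `p = J (Γ̇ × Γ) - b J Γ`, which is orthogonal to `Γ`, the derivative of the Routhian in the
direction `(δ, δ')` is `p · (δ' × Γ + Γ̇ × δ) + q · δ`. Integrating `δ' · (Γ × p)` by parts, and using
that `p`, `Γ̇` and `δ` are coplanar, one finds that the first variation minus the magnetic term is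
`∫ N · (δ × Γ)` with the residual `N = q × Γ - (p · Γ̇) Γ - c Γ̇ - ṗ`
(`hasDerivAt_integral_routhian`). As `N` is tangent to the sphere and the fields `φ u × Γ` are
variation fields, the variational equation is equivalent to `N = 0`
(`satisfiesVariationalEquation_iff_residual`).

It remains to read `N = 0` in two ways. Since `ṗ = J (Γ̈ × Γ - ḃ Γ - b Γ̇)` and `J` maps `Σ - b Γ̇` to
`N + ṗ`, it says `Γ̈ × Γ - ḃ Γ = Σ`, which is the reduced equation of motion
(`residual_eq_zero_iff`); the `Γ` component carries no information because `N · Γ = 0`. For a motion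
of the pendulum, `J ω = p + ν J Γ` by conservation of momentum, and differentiating this relation
gives `N = 0` (`IsMotion.residual_eq_zero`).
-/

namespace Pendulum

variable (P : Data) (μ : ℝ)

/-! ### Calculus of vector operations in `ℝ³` -/

lemma hasDerivWithinAt_cross {f g : ℝ → V3} {f' g' : V3} {s : Set ℝ} {x : ℝ}
    (hf : HasDerivWithinAt f f' s x) (hg : HasDerivWithinAt g g' s x) :
    HasDerivWithinAt (fun y => f y ⨯₃ g y) (f' ⨯₃ g x + f x ⨯₃ g') s x := by
  rw [hasDerivWithinAt_pi] at hf hg ⊢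
  intro i
  fin_cases i
  · convert! ((hf 1).mul (hg 2)).sub ((hf 2).mul (hg 1)) using 1
    simp [cross_apply]; ring
  · convert! ((hf 2).mul (hg 0)).sub ((hf 0).mul (hg 2)) using 1
    simp [cross_apply]; ring
  · convert! ((hf 0).mul (hg 1)).sub ((hf 1).mul (hg 0)) using 1
    simp [cross_apply]; ring

lemma hasDerivWithinAt_dot {f g : ℝ → V3} {f' g' : V3} {s : Set ℝ} {x : ℝ}
    (hf : HasDerivWithinAt f f' s x) (hg : HasDerivWithinAt g g' s x) :
    HasDerivWithinAt (fun y => f y ⬝ᵥ g y) (f' ⬝ᵥ g x + f x ⬝ᵥ g') s x := by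
  rw [hasDerivWithinAt_pi] at hf hg
  simp only [vec3_dotProduct]
  convert! (((hf 0).mul (hg 0)).add ((hf 1).mul (hg 1))).add ((hf 2).mul (hg 2)) using 1
  ring

lemma hasDerivWithinAt_mulVec (A : M3) {f : ℝ → V3} {f' : V3} {s : Set ℝ} {x : ℝ}
    (hf : HasDerivWithinAt f f' s x) :
    HasDerivWithinAt (fun y => A *ᵥ f y) (A *ᵥ f') s x :=
  (Matrix.mulVecLin A).toContinuousLinearMap.hasFDerivAt.comp_hasDerivWithinAt x hf

lemma contDiffOn_cross {E : Type*} [NormedAddCommGroup E] [NormedSpace ℝ E] {n : WithTop ℕ∞}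
    {f g : E → V3} {s : Set E} (hf : ContDiffOn ℝ n f s) (hg : ContDiffOn ℝ n g s) :
    ContDiffOn ℝ n (fun y => f y ⨯₃ g y) s := by
  rw [contDiffOn_pi] at hf hg ⊢
  intro i
  fin_cases i
  · exact ((hf 1).mul (hg 2)).sub ((hf 2).mul (hg 1))
  · exact ((hf 2).mul (hg 0)).sub ((hf 0).mul (hg 2))
  · exact ((hf 0).mul (hg 1)).sub ((hf 1).mul (hg 0))

lemma contDiffOn_dot {E : Type*} [NormedAddCommGroup E] [NormedSpace ℝ E] {n : WithTop ℕ∞}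
    {f g : E → V3} {s : Set E} (hf : ContDiffOn ℝ n f s) (hg : ContDiffOn ℝ n g s) :
    ContDiffOn ℝ n (fun y => f y ⬝ᵥ g y) s := by
  rw [contDiffOn_pi] at hf hg
  simp only [vec3_dotProduct]
  exact (((hf 0).mul (hg 0)).add ((hf 1).mul (hg 1))).add ((hf 2).mul (hg 2))

lemma contDiffOn_mulVec (A : M3) {E : Type*} [NormedAddCommGroup E] [NormedSpace ℝ E]
    {n : WithTop ℕ∞} {f : E → V3} {s : Set E} (hf : ContDiffOn ℝ n f s) :
    ContDiffOn ℝ n (fun y => A *ᵥ f y) s :=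
  (Matrix.mulVecLin A).toContinuousLinearMap.contDiff.comp_contDiffOn hf

lemma continuousOn_cross {E : Type*} [TopologicalSpace E] {f g : E → V3} {s : Set E}
    (hf : ContinuousOn f s) (hg : ContinuousOn g s) : ContinuousOn (fun y => f y ⨯₃ g y) s := by
  rw [continuousOn_pi] at hf hg ⊢
  intro i
  fin_cases i
  · exact ((hf 1).mul (hg 2)).sub ((hf 2).mul (hg 1))
  · exact ((hf 2).mul (hg 0)).sub ((hf 0).mul (hg 2))
  · exact ((hf 0).mul (hg 1)).sub ((hf 1).mul (hg 0))

lemma continuousOn_dot {E : Type*} [TopologicalSpace E] {f g : E → V3} {s : Set E}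
    (hf : ContinuousOn f s) (hg : ContinuousOn g s) : ContinuousOn (fun y => f y ⬝ᵥ g y) s := by
  rw [continuousOn_pi] at hf hg
  simp only [vec3_dotProduct]
  exact (((hf 0).mul (hg 0)).add ((hf 1).mul (hg 1))).add ((hf 2).mul (hg 2))

lemma continuousOn_mulVec (A : M3) {E : Type*} [TopologicalSpace E] {f : E → V3} {s : Set E}
    (hf : ContinuousOn f s) : ContinuousOn (fun y => A *ᵥ f y) s :=
  (Matrix.mulVecLin A).toContinuousLinearMap.continuous.comp_continuousOn hf

/-! ### The inertia matrix -/

lemma J_apply_comm (i j : Fin 3) : P.J i j = P.J j i := by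
  simpa using (P.J_posDef.isHermitian.apply j i)

lemma dot_J_comm (x y : V3) : x ⬝ᵥ (P.J *ᵥ y) = (P.J *ᵥ x) ⬝ᵥ y := by
  simp only [vec3_dotProduct, mulVec, J_apply_comm P 1 0, J_apply_comm P 2 0, J_apply_comm P 2 1]
  ring

lemma dot_J_pos {Γ : V3} (h : Γ ⬝ᵥ Γ = 1) : 0 < Γ ⬝ᵥ (P.J *ᵥ Γ) := by
  have h0 : Γ ≠ 0 := by rintro rfl; simp at h
  simpa using P.J_posDef.dotProduct_mulVec_pos h0

lemma J_inv_mulVec (x : V3) : P.J⁻¹ *ᵥ (P.J *ᵥ x) = x := by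
  rw [mulVec_mulVec, nonsing_inv_mul _ P.J_posDef.det_pos.ne'.isUnit, one_mulVec]

lemma J_mulVec_inv (x : V3) : P.J *ᵥ (P.J⁻¹ *ᵥ x) = x := by
  rw [mulVec_mulVec, mul_nonsing_inv _ P.J_posDef.det_pos.ne'.isUnit, one_mulVec]

/-- The derivative at the identity of the cofactor rule `(A u) × (A v) = cof(A) (u × v)`, for the
symmetric matrix `J`. -/
lemma J_cross_add_cross_J (u v : V3) :
    (P.J *ᵥ u) ⨯₃ v + u ⨯₃ (P.J *ᵥ v) = P.J.trace • (u ⨯₃ v) - P.J *ᵥ (u ⨯₃ v) := by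
  ext i
  simp only [Pi.add_apply, Pi.sub_apply, Pi.smul_apply, smul_eq_mul, cross_apply, mulVec,
    vec3_dotProduct, trace_fin_three]
  fin_cases i <;>
  · simp [J_apply_comm P 1 0, J_apply_comm P 2 0, J_apply_comm P 2 1]
    ring

/-! ### The projection to the sphere and the generator of the action -/

lemma proj_eq (R : M3) : proj R = R 2 := by
  ext i
  simp only [proj, e3, mulVec, vec3_dotProduct, transpose_apply]
  simp

lemma hasDerivAt_exp_apply (A : M3) (i j : Fin 3) :
    HasDerivAt (fun θ : ℝ => NormedSpace.exp (θ • A) i j) (A i j) 0 := by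
  open scoped Matrix.Norms.Operator in
  have h := hasDerivAt_exp_smul_const (𝕂 := ℝ) A (0 : ℝ)
  rw [zero_smul, NormedSpace.exp_zero, one_mul] at h
  exact hasDerivAt_pi.1 (hasDerivAt_pi.1 h i) j

/-- At an arbitrary matrix the generator is the cross product of the first two rows. -/
lemma generator_eq_cross (R : M3) : generator R = R 0 ⨯₃ R 1 := by
  have h : (Matrix.of fun i j => deriv (fun θ : ℝ => action θ R i j) 0) = hat e3 * R := by
    ext i j
    have h1 : HasDerivAt (fun θ : ℝ => action θ R i j) ((hat e3 * R) i j) 0 := by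
      simp only [action, Matrix.mul_apply]
      exact HasDerivAt.fun_sum fun k _ => (hasDerivAt_exp_apply (hat e3) i k).mul_const _
    simpa using h1.deriv
  rw [generator, h]
  ext i
  fin_cases i <;>
  · simp only [vee, cross_apply, Matrix.mul_apply, Fin.sum_univ_three, transpose_apply]
    simp [hat, e3]
    ring

lemma SO3_iff {R : M3} : R ∈ SO3 ↔ R * Rᵀ = 1 ∧ R.det = 1 := by
  simp [SO3, mem_specialOrthogonalGroup_iff, mem_orthogonalGroup_iff]

lemma cross_rows_of_mem_SO3 {R : M3} (hR : R ∈ SO3) : R 0 ⨯₃ R 1 = R 2 := by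
  obtain ⟨h1, h2⟩ := SO3_iff.1 hR
  have h : R.adjugate = Rᵀ := by
    rw [← Matrix.mul_one R.adjugate, ← h1, ← Matrix.mul_assoc, adjugate_mul, h2, one_smul,
      Matrix.one_mul]
  ext i
  have hi := congrFun (congrFun h i) 2
  rw [adjugate_fin_three] at hi
  fin_cases i <;> simp [cross_apply] at hi ⊢ <;> linarith

/-- On `SO(3)` the generator, in body coordinates, is the vertical direction `Γ = Rᵀ e₃`. -/
lemma generator_eq_proj {R : M3} (hR : R ∈ SO3) : generator R = proj R := by
  rw [generator_eq_cross, proj_eq, cross_rows_of_mem_SO3 hR]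

lemma proj_unit {R : M3} (hR : R ∈ SO3) : proj R ⬝ᵥ proj R = 1 := by
  have h := congrFun (congrFun (SO3_iff.1 hR).1 2) 2
  rw [proj_eq]
  simpa [Matrix.mul_apply', Matrix.transpose] using h

/-- A unit vector has a unit normal: the direction `(-Γ₁, Γ₀, 0)`, unless that is zero. -/
lemma exists_unit_orthogonal (Γ : V3) : ∃ u : V3, u ⬝ᵥ u = 1 ∧ Γ ⬝ᵥ u = 0 := by
  by_cases h : Γ 0 ^ 2 + Γ 1 ^ 2 = 0
  · have h0 : Γ 0 = 0 := by nlinarith [sq_nonneg (Γ 0), sq_nonneg (Γ 1)]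
    exact ⟨![1, 0, 0], by simp, by rw [vec3_dotProduct]; simp [h0]⟩
  · have hs : √(Γ 0 ^ 2 + Γ 1 ^ 2) ^ 2 = Γ 0 ^ 2 + Γ 1 ^ 2 := Real.sq_sqrt (by positivity)
    have hs0 : √(Γ 0 ^ 2 + Γ 1 ^ 2) ≠ 0 := by
      intro h'; rw [h'] at hs; apply h; rw [← hs]; norm_num
    refine ⟨(√(Γ 0 ^ 2 + Γ 1 ^ 2))⁻¹ • ![-Γ 1, Γ 0, 0], ?_, ?_⟩
    · simp
      field_simp
      rw [hs]; ring
    · rw [vec3_dotProduct]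
      simp
      ring

lemma exists_mem_SO3_proj_eq {Γ : V3} (h : Γ ⬝ᵥ Γ = 1) : ∃ R ∈ SO3, proj R = Γ := by
  obtain ⟨u, hu, hΓu⟩ := exists_unit_orthogonal Γ
  refine ⟨Matrix.of ![u, Γ ⨯₃ u, Γ], SO3_iff.2 ⟨?_, ?_⟩, by rw [proj_eq]; rfl⟩
  · have huΓ : u ⬝ᵥ Γ = 0 := by rw [dotProduct_comm, hΓu]
    have h1 : (Γ ⨯₃ u) ⬝ᵥ (Γ ⨯₃ u) = 1 := by rw [cross_dot_cross, h, hu, hΓu, huΓ]; norm_num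
    have h2 : u ⬝ᵥ (Γ ⨯₃ u) = 0 := dot_cross_self _ _
    have h3 : Γ ⬝ᵥ (Γ ⨯₃ u) = 0 := dot_self_cross _ _
    have h2' : (Γ ⨯₃ u) ⬝ᵥ u = 0 := by rw [dotProduct_comm, h2]
    have h3' : (Γ ⨯₃ u) ⬝ᵥ Γ = 0 := by rw [dotProduct_comm, h3]
    ext i j
    rw [Matrix.mul_apply']
    fin_cases i <;> fin_cases j
    · exact hu
    · exact h2
    · exact huΓ
    · exact h2'
    · exact h1
    · exact h3'
    · exact hΓu
    · exact h3
    · exact h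
  · have := triple_product_eq_det u (Γ ⨯₃ u) Γ
    rw [show Matrix.of ![u, Γ ⨯₃ u, Γ] = ![u, Γ ⨯₃ u, Γ] from rfl, ← this,
      cross_cross_eq_smul_sub_smul, h, dotProduct_comm u Γ, hΓu, one_smul, zero_smul, sub_zero, hu]

/-! ### The Routhian -/

/-- The Routhian as an explicit function of `(Γ, Γ̇)`, defined on all of `ℝ³ × ℝ³`. -/
noncomputable def routhian (Γ Γ' : V3) : ℝ :=
  (1 / 2) * ((Γ' ⨯₃ Γ) ⬝ᵥ (P.J *ᵥ (Γ' ⨯₃ Γ)))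
    - (1 / 2) * ((bCoeff P Γ Γ') ^ 2 + (nuCoeff P μ Γ) ^ 2) * (Γ ⬝ᵥ (P.J *ᵥ Γ))
    + P.m * P.g * (Γ ⬝ᵥ P.ρ)

lemma momentum_eq {R : M3} (hR : R ∈ SO3) (ω : V3) :
    momentum P R ω = ω ⬝ᵥ (P.J *ᵥ proj R) := by
  rw [momentum, metric, generator_eq_proj hR]

lemma cross_cross_unit {Γ : V3} (h : Γ ⬝ᵥ Γ = 1) (ω : V3) :
    (Γ ⨯₃ ω) ⨯₃ Γ = ω - (Γ ⬝ᵥ ω) • Γ := by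
  rw [cross_cross_eq_smul_sub_smul, h, one_smul, dotProduct_comm ω]

lemma isRouthian_routhian : IsRouthian P μ (routhian P μ) := by
  intro R hR ω hω
  have h1 := proj_unit hR
  have hk := (dot_J_pos P h1).ne'
  have hm : ω ⬝ᵥ (P.J *ᵥ proj R) = μ := by rw [← momentum_eq P hR, hω]
  have hm' : (P.J *ᵥ proj R) ⬝ᵥ ω = μ := by rw [dotProduct_comm, hm]
  have hm'' : proj R ⬝ᵥ (P.J *ᵥ ω) = μ := by rw [dot_J_comm, hm']
  rw [connectionForm, connection, hω, lockedInertia, metric, generator_eq_proj hR, lagrangian,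
    metric, routhian, bCoeff, nuCoeff, cross_cross_unit h1, dotProduct_comm P.ρ]
  simp only [mulVec_sub, mulVec_smul, sub_dotProduct, dotProduct_sub, smul_dotProduct,
    dotProduct_smul, smul_eq_mul, hm, hm', hm'', dotProduct_comm (P.J *ᵥ proj R) (proj R)]
  field_simp
  ring

/-- Every tangent vector of the sphere is the image of a vector tangent to the level set `𝐉 = μ`:
the vertical component of `ω` is free, and the momentum is an affine function of it. -/
lemma IsRouthian.eq_routhian {F : V3 → V3 → ℝ} (hF : IsRouthian P μ F) {Γ Γ' : V3}
    (h : Γ ⬝ᵥ Γ = 1) (h' : Γ ⬝ᵥ Γ' = 0) : F Γ Γ' = routhian P μ Γ Γ' := by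
  obtain ⟨R, hR, rfl⟩ := exists_mem_SO3_proj_eq h
  have hk := (dot_J_pos P h).ne'
  set Γ := proj R
  set s := (μ - (Γ' ⨯₃ Γ) ⬝ᵥ (P.J *ᵥ Γ)) / (Γ ⬝ᵥ (P.J *ᵥ Γ)) with hs
  have hω : momentum P R (Γ' ⨯₃ Γ + s • Γ) = μ := by
    rw [momentum_eq P hR, add_dotProduct, smul_dotProduct, smul_eq_mul, hs,
      div_mul_cancel₀ _ hk]
    ring
  have hΓ' : Γ ⨯₃ (Γ' ⨯₃ Γ + s • Γ) = Γ' := by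
    rw [map_add, map_smul, cross_self, smul_zero, add_zero, cross_cross_eq_smul_sub_smul', h,
      dotProduct_comm Γ' Γ, h']
    simp
  have h1 := hF R hR _ hω
  have h2 := isRouthian_routhian P μ R hR _ hω
  rw [hΓ'] at h1 h2
  rw [h1, h2]

/-! ### The magnetic two-form -/

/-- The magnetic two-form `c Γ · (u × v)`, a multiple of the area form of the sphere. -/
noncomputable def magneticForm (Γ : V3) : V3 [⋀^Fin 2]→ₗ[ℝ] ℝ :=
  cCoeff P μ Γ • (Matrix.detRowAlternating (n := Fin 3) (R := ℝ)).curryLeft Γ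

lemma magneticForm_apply (Γ u v : V3) :
    magneticForm P μ Γ ![u, v] = cCoeff P μ Γ * (Γ ⬝ᵥ (u ⨯₃ v)) := by
  rw [triple_product_eq_det]
  rfl

/-- Differentiating the rows `R₀`, `R₁` along `R η̂` gives `R₀ × η`, `R₁ × η`; the Jacobi identity turns
this into the derivative of `R₀ × R₁`. -/
lemma hasDerivAt_generator {R : M3} (hR : R ∈ SO3) (η : V3) :
    HasDerivWithinAt (fun s : ℝ => generator (R * NormedSpace.exp (s • hat η)))
      (proj R ⨯₃ η) univ 0 := by
  have hrow : ∀ i, HasDerivWithinAt (fun s : ℝ => (R * NormedSpace.exp (s • hat η)) i)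
      (R i ⨯₃ η) univ 0 := by
    intro i
    rw [hasDerivWithinAt_univ, hasDerivAt_pi]
    intro j
    have h1 : HasDerivAt (fun s : ℝ => (R * NormedSpace.exp (s • hat η)) i j)
        ((R * hat η) i j) 0 := by
      simp only [Matrix.mul_apply]
      exact HasDerivAt.fun_sum fun k _ => (hasDerivAt_exp_apply (hat η) k j).const_mul _
    convert! h1 using 1
    simp only [Matrix.mul_apply, Fin.sum_univ_three, cross_apply]
    fin_cases j <;> simp [hat] <;> ring
  have h := hasDerivWithinAt_cross (hrow 0) (hrow 1)
  simp only [zero_smul, NormedSpace.exp_zero, Matrix.mul_one] at h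
  simp only [generator_eq_cross]
  convert! h using 1
  rw [proj_eq, ← cross_rows_of_mem_SO3 hR, cross_cross]
  rw [← cross_anticomm (R 0 ⨯₃ η) (R 1)]
  abel

lemma leftDeriv_connectionForm {R : M3} (hR : R ∈ SO3) (η ζ : V3) :
    leftDeriv (fun Q => connectionForm P μ Q ζ) R η =
      μ * ((ζ ⬝ᵥ (P.J *ᵥ (proj R ⨯₃ η))) / (proj R ⬝ᵥ (P.J *ᵥ proj R))
        - 2 * ((P.J *ᵥ proj R) ⬝ᵥ (proj R ⨯₃ η)) * (ζ ⬝ᵥ (P.J *ᵥ proj R))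
          / (proj R ⬝ᵥ (P.J *ᵥ proj R)) ^ 2) := by
  have hk := (dot_J_pos P (proj_unit hR)).ne'
  have h0 : generator (R * NormedSpace.exp ((0 : ℝ) • hat η)) = proj R := by
    rw [zero_smul, NormedSpace.exp_zero, Matrix.mul_one, generator_eq_proj hR]
  have hg := hasDerivAt_generator hR η
  have h1 := hasDerivWithinAt_dot hg (hasDerivWithinAt_mulVec P.J hg)
  have h2 := hasDerivWithinAt_dot (hasDerivWithinAt_const (0 : ℝ) univ ζ)
    (hasDerivWithinAt_mulVec P.J hg)
  have h3 := ((h1.inv (by rw [h0]; exact hk)).mul h2).const_mul μ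
  rw [hasDerivWithinAt_univ] at h3
  refine h3.deriv.trans ?_
  simp only [Pi.inv_apply, h0, zero_dotProduct, zero_add]
  rw [dot_J_comm P (proj R) (proj R ⨯₃ η), dotProduct_comm (proj R ⨯₃ η)]
  field_simp
  ring

/-- The terms of `d𝒜_μ` containing `(η × ζ) · J Γ` cancel, which leaves a multiple of the area form. -/
lemma extDeriv_connectionForm {R : M3} (hR : R ∈ SO3) (η ζ : V3) :
    extDerivOneForm (connectionForm P μ) R η ζ =
      cCoeff P μ (proj R) * (proj R ⬝ᵥ (η ⨯₃ ζ)) := by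
  have hk := (dot_J_pos P (proj_unit hR)).ne'
  rw [extDerivOneForm, leftDeriv_connectionForm P μ hR, leftDeriv_connectionForm P μ hR,
    connectionForm, connection, momentum_eq P hR, lockedInertia, metric, generator_eq_proj hR,
    cCoeff, nuCoeff]
  set Γ := proj R
  have e1 : ζ ⬝ᵥ (P.J *ᵥ (Γ ⨯₃ η)) - η ⬝ᵥ (P.J *ᵥ (Γ ⨯₃ ζ)) =
      P.J.trace * (Γ ⬝ᵥ (η ⨯₃ ζ)) - (η ⨯₃ ζ) ⬝ᵥ (P.J *ᵥ Γ) := by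
    have h := congrArg (fun x => Γ ⬝ᵥ x) (J_cross_add_cross_J P η ζ)
    simp only [dotProduct_add, dotProduct_sub, dotProduct_smul, smul_eq_mul] at h
    rw [dot_J_comm P Γ (η ⨯₃ ζ), dotProduct_comm (P.J *ᵥ Γ)] at h
    rw [← h, dot_J_comm, dot_J_comm P η, triple_product_permutation (P.J *ᵥ ζ),
      triple_product_permutation (P.J *ᵥ η), ← cross_anticomm (P.J *ᵥ η) ζ, dotProduct_neg]
    ring
  have e2 : ((P.J *ᵥ Γ) ⬝ᵥ (Γ ⨯₃ η)) * (ζ ⬝ᵥ (P.J *ᵥ Γ))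
      - ((P.J *ᵥ Γ) ⬝ᵥ (Γ ⨯₃ ζ)) * (η ⬝ᵥ (P.J *ᵥ Γ)) =
      ((P.J *ᵥ Γ) ⬝ᵥ (P.J *ᵥ Γ)) * (Γ ⬝ᵥ (η ⨯₃ ζ))
        - (Γ ⬝ᵥ (P.J *ᵥ Γ)) * ((η ⨯₃ ζ) ⬝ᵥ (P.J *ᵥ Γ)) := by
    generalize P.J *ᵥ Γ = a
    simp only [cross_apply, vec3_dotProduct, cons_val]
    ring
  field_simp
  linear_combination μ * (Γ ⬝ᵥ (P.J *ᵥ Γ)) * e1 - 2 * μ * e2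

lemma cross_cross_cross_self (Γ η ζ : V3) :
    Γ ⬝ᵥ ((Γ ⨯₃ η) ⨯₃ (Γ ⨯₃ ζ)) = (Γ ⬝ᵥ Γ) * (Γ ⬝ᵥ (η ⨯₃ ζ)) := by
  simp only [cross_apply, vec3_dotProduct, cons_val]
  ring

lemma isMagneticForm_magneticForm : IsMagneticForm P μ (magneticForm P μ) := by
  intro R hR η ζ
  rw [extDeriv_connectionForm P μ hR, magneticForm_apply, cross_cross_cross_self, proj_unit hR,
    one_mul]

lemma IsMagneticForm.apply_cross {β : V3 → V3 [⋀^Fin 2]→ₗ[ℝ] ℝ} (hβ : IsMagneticForm P μ β)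
    {Γ : V3} (h : Γ ⬝ᵥ Γ = 1) (η ζ : V3) :
    β Γ ![Γ ⨯₃ η, Γ ⨯₃ ζ] = cCoeff P μ Γ * (Γ ⬝ᵥ (η ⨯₃ ζ)) := by
  obtain ⟨R, hR, rfl⟩ := exists_mem_SO3_proj_eq h
  rw [hβ R hR, extDeriv_connectionForm P μ hR]

lemma IsMagneticForm.apply_tangent {β : V3 → V3 [⋀^Fin 2]→ₗ[ℝ] ℝ} (hβ : IsMagneticForm P μ β)
    {Γ u v : V3} (h : Γ ⬝ᵥ Γ = 1) (hu : Γ ⬝ᵥ u = 0) (hv : Γ ⬝ᵥ v = 0) :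
    β Γ ![u, v] = cCoeff P μ Γ * (Γ ⬝ᵥ (u ⨯₃ v)) := by
  have lift : ∀ x : V3, Γ ⬝ᵥ x = 0 → Γ ⨯₃ (x ⨯₃ Γ) = x := by
    intro x hx
    rw [cross_cross_eq_smul_sub_smul', h, dotProduct_comm x Γ, hx, one_smul, zero_smul, sub_zero]
  have h1 := hβ.apply_cross P μ h (u ⨯₃ Γ) (v ⨯₃ Γ)
  have h2 := cross_cross_cross_self Γ (u ⨯₃ Γ) (v ⨯₃ Γ)
  rw [lift u hu, lift v hv] at h1 h2
  rw [h1, h2, h, one_mul]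

lemma cCoeff_eq {Γ : V3} (h : Γ ⬝ᵥ Γ = 1) :
    cCoeff P μ Γ = -(μ / (Γ ⬝ᵥ (P.J *ᵥ Γ)) ^ 2) *
      (-(Γ ⬝ᵥ (P.J *ᵥ Γ)) * P.J.trace + 2 * ((P.J *ᵥ Γ) ⬝ᵥ (P.J *ᵥ Γ))) := by
  have hk := (dot_J_pos P h).ne'
  rw [cCoeff, nuCoeff]
  field_simp
  ring

/-! ### One-parameter families on a compact interval -/

section Strip

variable {E : Type*} [NormedAddCommGroup E] [NormedSpace ℝ E] {T : ℝ}

lemma uniqueDiffOn_strip (hT : 0 < T) : UniqueDiffOn ℝ ((univ : Set ℝ) ×ˢ Icc (0 : ℝ) T) :=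
  uniqueDiffOn_univ.prod (uniqueDiffOn_Icc hT)

lemma hasDerivAt_fst_of_strip {g : ℝ × ℝ → E} {g' : ℝ × ℝ →L[ℝ] E} {ε t : ℝ} (ht : t ∈ Icc 0 T)
    (h : HasFDerivWithinAt g g' (univ ×ˢ Icc 0 T) (ε, t)) :
    HasDerivAt (fun e => g (e, t)) (g' (1, 0)) ε := by
  rw [← hasDerivWithinAt_univ]
  refine h.comp_hasDerivWithinAt (f := fun e : ℝ => (e, t)) ε ?_ (fun e _ => ⟨mem_univ _, ht⟩)
  exact (hasDerivWithinAt_id ε univ).prodMk (hasDerivWithinAt_const ε univ t)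

lemma hasDerivWithinAt_snd_of_strip {g : ℝ × ℝ → E} {g' : ℝ × ℝ →L[ℝ] E} {ε t : ℝ}
    (h : HasFDerivWithinAt g g' (univ ×ˢ Icc 0 T) (ε, t)) :
    HasDerivWithinAt (fun s => g (ε, s)) (g' (0, 1)) (Icc 0 T) t := by
  refine h.comp_hasDerivWithinAt (f := fun s : ℝ => (ε, s)) t ?_ (fun s hs => ⟨mem_univ _, hs⟩)
  exact (hasDerivWithinAt_const t (Icc 0 T) ε).prodMk (hasDerivWithinAt_id t (Icc 0 T))

lemma hasDerivAt_integral_of_contDiffOn_strip (hT : 0 < T) {A : ℝ × ℝ → ℝ}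
    (hA : ContDiffOn ℝ 1 A (univ ×ˢ Icc 0 T)) :
    HasDerivAt (fun ε => ∫ t in (0 : ℝ)..T, A (ε, t))
      (∫ t in (0 : ℝ)..T, deriv (fun ε => A (ε, t)) 0) 0 := by
  have hS := uniqueDiffOn_strip hT
  set S : Set (ℝ × ℝ) := univ ×ˢ Icc 0 T
  have hd : ∀ ε, ∀ t ∈ Icc 0 T,
      HasDerivAt (fun e => A (e, t)) (fderivWithin ℝ A S (ε, t) (1, 0)) ε := fun ε t ht =>
    hasDerivAt_fst_of_strip ht
      ((hA.differentiableOn one_ne_zero) (ε, t) ⟨mem_univ _, ht⟩).hasFDerivWithinAt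
  have hc : ContinuousOn (fun p => fderivWithin ℝ A S p (1, 0)) S :=
    (hA.continuousOn_fderivWithin hS le_rfl).clm_apply continuousOn_const
  have hslice : ∀ {B : ℝ × ℝ → ℝ}, ContinuousOn B S → ∀ ε,
      ContinuousOn (fun t => B (ε, t)) (Icc 0 T) := fun {B} hB ε =>
    hB.comp (by fun_prop) (fun t ht => ⟨mem_univ _, ht⟩)
  obtain ⟨C, hC⟩ := ((isCompact_Icc (a := (-1 : ℝ)) (b := 1)).prod
    (isCompact_Icc (a := (0 : ℝ)) (b := T))).exists_bound_of_continuousOn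
      (hc.mono (prod_mono (subset_univ _) Subset.rfl))
  have hI : uIoc (0 : ℝ) T ⊆ Icc 0 T := by
    rw [uIoc_of_le hT.le]; exact Ioc_subset_Icc_self
  have hii : ∀ {f : ℝ → ℝ}, ContinuousOn f (Icc 0 T) → IntervalIntegrable f volume 0 T :=
    fun h => ContinuousOn.intervalIntegrable (by rwa [uIcc_of_le hT.le])
  have key := (intervalIntegral.hasDerivAt_integral_of_dominated_loc_of_deriv_le (μ := volume)
    (F := fun ε t => A (ε, t)) (F' := fun ε t => fderivWithin ℝ A S (ε, t) (1, 0))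
    (bound := fun _ => C) (x₀ := 0) (a := 0) (b := T)
    (Icc_mem_nhds (by norm_num : (-1 : ℝ) < 0) (by norm_num : (0 : ℝ) < 1))
    (Filter.Eventually.of_forall fun ε =>
      (intervalIntegrable_iff.1 (hii (hslice hA.continuousOn ε))).aestronglyMeasurable)
    (hii (hslice hA.continuousOn 0))
    (intervalIntegrable_iff.1 (hii (hslice hc 0))).aestronglyMeasurable
    (ae_of_all _ fun t ht ε hε => hC (ε, t) ⟨hε, hI ht⟩)
    intervalIntegrable_const
    (ae_of_all _ fun t ht ε _ => hd ε t (hI ht))).2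
  convert! key using 1
  refine intervalIntegral.integral_congr fun t ht => ?_
  rw [uIcc_of_le hT.le] at ht
  exact (hd 0 t ht).deriv

lemma contDiffOn_derivWithin_strip (hT : 0 < T) {g : ℝ × ℝ → E}
    (hg : ContDiffOn ℝ 2 g (univ ×ˢ Icc 0 T)) :
    ContDiffOn ℝ 1 (fun p : ℝ × ℝ => derivWithin (fun s => g (p.1, s)) (Icc 0 T) p.2)
      (univ ×ˢ Icc 0 T) := by
  have hS := uniqueDiffOn_strip hT
  have h1 : ContDiffOn ℝ 1 (fderivWithin ℝ g (univ ×ˢ Icc 0 T)) (univ ×ˢ Icc 0 T) :=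
    hg.fderivWithin hS (by norm_num)
  refine (h1.clm_apply (contDiffOn_const (c := ((0 : ℝ), (1 : ℝ))))).congr fun p hp => ?_
  exact (hasDerivWithinAt_snd_of_strip
    ((hg.differentiableOn two_ne_zero) p hp).hasFDerivWithinAt).derivWithin
      (uniqueDiffOn_Icc hT p.2 hp.2)

/-- The variation field `δ = ∂g/∂ε|₀` of a `C²` family `g(ε, t)` is `C¹` in `t`, and its derivative
`δ'` is the variation of the velocity `∂g/∂t`, by the symmetry of the second derivative. -/
lemma exists_variation_field (hT : 0 < T) {g : ℝ × ℝ → E}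
    (hg : ContDiffOn ℝ 2 g (univ ×ˢ Icc 0 T)) :
    ∃ δ δ' : ℝ → E, ContinuousOn δ' (Icc 0 T) ∧ ∀ t ∈ Icc 0 T,
      HasDerivAt (fun ε => g (ε, t)) (δ t) 0 ∧ HasDerivWithinAt δ (δ' t) (Icc 0 T) t ∧
      HasDerivAt (fun ε => derivWithin (fun s => g (ε, s)) (Icc 0 T) t) (δ' t) 0 := by
  have hS := uniqueDiffOn_strip hT
  set S : Set (ℝ × ℝ) := univ ×ˢ Icc 0 T with hSdef
  have h1 : ContDiffOn ℝ 1 (fderivWithin ℝ g S) S := hg.fderivWithin hS (by norm_num)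
  have hmem : ∀ ε : ℝ, ∀ t ∈ Icc 0 T, (ε, t) ∈ S := fun ε t ht => ⟨mem_univ _, ht⟩
  have hd1 : ∀ p ∈ S, HasFDerivWithinAt g (fderivWithin ℝ g S p) S p := fun p hp =>
    ((hg.differentiableOn two_ne_zero) p hp).hasFDerivWithinAt
  have hd2 : ∀ p ∈ S, ∀ v, HasFDerivWithinAt (fun p => fderivWithin ℝ g S p v)
      ((ContinuousLinearMap.apply ℝ E v).comp (fderivWithin ℝ (fderivWithin ℝ g S) S p)) S p :=
    fun p hp v => (ContinuousLinearMap.apply ℝ E v).hasFDerivAt.comp_hasFDerivWithinAt p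
      ((h1.differentiableOn one_ne_zero) p hp).hasFDerivWithinAt
  have hsymm : ∀ p ∈ S, IsSymmSndFDerivWithinAt ℝ g S p := by
    intro p hp
    refine (hg p hp).isSymmSndFDerivWithinAt (by simp) hS ?_ hp
    rw [hSdef, interior_prod_eq, interior_univ, interior_Icc, closure_prod_eq, closure_univ,
      closure_Ioo hT.ne]
    exact hp
  refine ⟨fun t => fderivWithin ℝ g S (0, t) (1, 0),
    fun t => fderivWithin ℝ (fderivWithin ℝ g S) S (0, t) (0, 1) (1, 0), ?_, fun t ht => ?_⟩
  · have hc : ContinuousOn (fun p => fderivWithin ℝ (fderivWithin ℝ g S) S p (0, 1) (1, 0)) S :=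
      ((h1.continuousOn_fderivWithin hS le_rfl).clm_apply continuousOn_const).clm_apply
        continuousOn_const
    exact hc.comp (by fun_prop) (fun t ht => hmem 0 t ht)
  · refine ⟨hasDerivAt_fst_of_strip ht (hd1 _ (hmem 0 t ht)),
      hasDerivWithinAt_snd_of_strip (hd2 _ (hmem 0 t ht) (1, 0)), ?_⟩
    have h := hasDerivAt_fst_of_strip ht (hd2 _ (hmem 0 t ht) (0, 1))
    have heq : (fun ε => derivWithin (fun s => g (ε, s)) (Icc 0 T) t) =
        fun ε => fderivWithin ℝ g S (ε, t) (0, 1) := funext fun ε =>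
      (hasDerivWithinAt_snd_of_strip (hd1 _ (hmem ε t ht))).derivWithin
        (uniqueDiffOn_Icc hT t ht)
    rw [heq]
    beta_reduce
    rw [hsymm _ (hmem 0 t ht) (0, 1) (1, 0)]
    exact h

end Strip

/-- The fundamental lemma of the calculus of variations on `[0, T]`. -/
lemma eqOn_zero_of_integral_smooth_mul_eq_zero {T : ℝ} (hT : 0 < T) {f : ℝ → ℝ}
    (hf : ContinuousOn f (Icc 0 T))
    (h : ∀ φ : ℝ → ℝ, ContDiff ℝ 2 φ → φ 0 = 0 → φ T = 0 →
      ∫ t in (0 : ℝ)..T, φ t * f t = 0) :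
    ∀ t ∈ Icc 0 T, f t = 0 := by
  have hae : ∀ᵐ t, t ∈ Ioo 0 T → f t = 0 := by
    refine isOpen_Ioo.ae_eq_zero_of_integral_contDiff_smul_eq_zero
      ((hf.mono Ioo_subset_Icc_self).locallyIntegrableOn measurableSet_Ioo) ?_
    intro φ hφ _ hsupp
    have hout : ∀ t, t ∉ Ioo 0 T → φ t = 0 := fun t ht =>
      image_eq_zero_of_notMem_tsupport fun h' => ht (hsupp h')
    have h0 := h φ (hφ.of_le (by norm_cast)) (hout 0 (by simp)) (hout T (by simp))
    rw [intervalIntegral.integral_of_le hT.le, integral_Ioc_eq_integral_Ioo] at h0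
    rw [← h0, setIntegral_eq_integral_of_forall_compl_eq_zero]
    · rfl
    · intro t ht
      rw [hout t ht, zero_mul]
  have hIoo : EqOn f 0 (Ioo 0 T) := by
    refine Measure.eqOn_open_of_ae_eq (μ := volume) ?_ isOpen_Ioo (hf.mono Ioo_subset_Icc_self)
      continuousOn_const
    rw [Filter.EventuallyEq, ae_restrict_iff' measurableSet_Ioo]
    exact hae
  intro t ht
  exact (hIoo.of_subset_closure hf continuousOn_const Ioo_subset_Icc_self
    (closure_Ioo hT.ne).ge) ht

/-! ### The first variation of the Routhian -/

/-- The momentum `p = J (Γ̇ × Γ) - b J Γ` of the reduced system. It is orthogonal to `Γ`, and `Γ × p`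
is the derivative of the Routhian with respect to `Γ̇`. -/
noncomputable def reducedMomentum (Γ Γ' : V3) : V3 :=
  P.J *ᵥ (Γ' ⨯₃ Γ) - bCoeff P Γ Γ' • (P.J *ᵥ Γ)

/-- The part `q = -b p + ν² J Γ + m g ρ` of the derivative of the Routhian with respect to `Γ` that
does not come from the dependence of `Γ̇ × Γ` on `Γ`. -/
noncomputable def reducedForce (Γ Γ' : V3) : V3 :=
  (nuCoeff P μ Γ) ^ 2 • (P.J *ᵥ Γ) + (P.m * P.g) • P.ρ - bCoeff P Γ Γ' • reducedMomentum P Γ Γ'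

lemma dot_reducedMomentum {Γ : V3} (h : Γ ⬝ᵥ Γ = 1) (Γ' : V3) :
    Γ ⬝ᵥ reducedMomentum P Γ Γ' = 0 := by
  have hk := (dot_J_pos P h).ne'
  rw [reducedMomentum, bCoeff, dotProduct_sub, dotProduct_smul, smul_eq_mul, div_mul_cancel₀ _ hk,
    dot_J_comm, sub_self]

section Smoothness

variable {E : Type*} [NormedAddCommGroup E] [NormedSpace ℝ E] {n : WithTop ℕ∞} {x y : E → V3}
  {s : Set E}

lemma contDiffOn_bCoeff (hx : ContDiffOn ℝ n x s) (hy : ContDiffOn ℝ n y s)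
    (h : ∀ z ∈ s, x z ⬝ᵥ x z = 1) : ContDiffOn ℝ n (fun z => bCoeff P (x z) (y z)) s :=
  (contDiffOn_dot (contDiffOn_mulVec P.J hx) (contDiffOn_cross hy hx)).div
    (contDiffOn_dot hx (contDiffOn_mulVec P.J hx)) fun z hz => (dot_J_pos P (h z hz)).ne'

lemma contDiffOn_nuCoeff (hx : ContDiffOn ℝ n x s) (h : ∀ z ∈ s, x z ⬝ᵥ x z = 1) :
    ContDiffOn ℝ n (fun z => nuCoeff P μ (x z)) s :=
  contDiffOn_const.div (contDiffOn_dot hx (contDiffOn_mulVec P.J hx))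
    fun z hz => (dot_J_pos P (h z hz)).ne'

lemma contDiffOn_cCoeff (hx : ContDiffOn ℝ n x s) (h : ∀ z ∈ s, x z ⬝ᵥ x z = 1) :
    ContDiffOn ℝ n (fun z => cCoeff P μ (x z)) s :=
  have hJ := contDiffOn_mulVec P.J hx
  (contDiffOn_nuCoeff P μ hx h).mul (contDiffOn_const.sub (contDiffOn_const.mul
    ((contDiffOn_dot hJ hJ).div (contDiffOn_dot hx hJ) fun z hz => (dot_J_pos P (h z hz)).ne')))

lemma contDiffOn_reducedMomentum (hx : ContDiffOn ℝ n x s) (hy : ContDiffOn ℝ n y s)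
    (h : ∀ z ∈ s, x z ⬝ᵥ x z = 1) : ContDiffOn ℝ n (fun z => reducedMomentum P (x z) (y z)) s :=
  (contDiffOn_mulVec P.J (contDiffOn_cross hy hx)).sub
    ((contDiffOn_bCoeff P hx hy h).smul (contDiffOn_mulVec P.J hx))

lemma contDiffOn_reducedForce (hx : ContDiffOn ℝ n x s) (hy : ContDiffOn ℝ n y s)
    (h : ∀ z ∈ s, x z ⬝ᵥ x z = 1) : ContDiffOn ℝ n (fun z => reducedForce P μ (x z) (y z)) s :=
  ((((contDiffOn_nuCoeff P μ hx h).pow 2).smul (contDiffOn_mulVec P.J hx)).add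
    contDiffOn_const).sub ((contDiffOn_bCoeff P hx hy h).smul (contDiffOn_reducedMomentum P hx hy h))

lemma contDiffOn_routhian (hx : ContDiffOn ℝ n x s) (hy : ContDiffOn ℝ n y s)
    (h : ∀ z ∈ s, x z ⬝ᵥ x z = 1) : ContDiffOn ℝ n (fun z => routhian P μ (x z) (y z)) s :=
  have hw := contDiffOn_cross hy hx
  ((contDiffOn_const.mul (contDiffOn_dot hw (contDiffOn_mulVec P.J hw))).sub
    ((contDiffOn_const.mul (((contDiffOn_bCoeff P hx hy h).pow 2).add
      ((contDiffOn_nuCoeff P μ hx h).pow 2))).mul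
        (contDiffOn_dot hx (contDiffOn_mulVec P.J hx)))).add
    (contDiffOn_const.mul (contDiffOn_dot hx contDiffOn_const))

end Smoothness

lemma hasDerivWithinAt_bCoeff {x y : ℝ → V3} {x' y' : V3} {s : Set ℝ} {τ : ℝ}
    (hx : HasDerivWithinAt x x' s τ) (hy : HasDerivWithinAt y y' s τ)
    (h : x τ ⬝ᵥ x τ = 1) :
    HasDerivWithinAt (fun z => bCoeff P (x z) (y z))
      (((P.J *ᵥ x') ⬝ᵥ (y τ ⨯₃ x τ) + (P.J *ᵥ x τ) ⬝ᵥ (y' ⨯₃ x τ + y τ ⨯₃ x')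
        - 2 * bCoeff P (x τ) (y τ) * ((P.J *ᵥ x τ) ⬝ᵥ x')) / (x τ ⬝ᵥ (P.J *ᵥ x τ))) s τ := by
  have hk := (dot_J_pos P h).ne'
  have hJ := hasDerivWithinAt_mulVec P.J hx
  refine ((hasDerivWithinAt_dot hJ (hasDerivWithinAt_cross hy hx)).div
    (hasDerivWithinAt_dot hx hJ) hk).congr_deriv ?_
  rw [bCoeff, dot_J_comm P (x τ) x', dotProduct_comm x']
  field_simp
  ring

lemma hasDerivWithinAt_nuCoeff {x : ℝ → V3} {x' : V3} {s : Set ℝ} {τ : ℝ}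
    (hx : HasDerivWithinAt x x' s τ) (h : x τ ⬝ᵥ x τ = 1) :
    HasDerivWithinAt (fun z => nuCoeff P μ (x z))
      (-2 * nuCoeff P μ (x τ) * ((P.J *ᵥ x τ) ⬝ᵥ x') / (x τ ⬝ᵥ (P.J *ᵥ x τ))) s τ := by
  have hk := (dot_J_pos P h).ne'
  refine ((hasDerivWithinAt_const τ s μ).div
    (hasDerivWithinAt_dot hx (hasDerivWithinAt_mulVec P.J hx)) hk).congr_deriv ?_
  rw [nuCoeff, dot_J_comm P (x τ) x', dotProduct_comm x']
  field_simp
  ring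

lemma hasDerivWithinAt_routhian {x y : ℝ → V3} {x' y' : V3} {s : Set ℝ} {τ : ℝ}
    (hx : HasDerivWithinAt x x' s τ) (hy : HasDerivWithinAt y y' s τ)
    (h : x τ ⬝ᵥ x τ = 1) :
    HasDerivWithinAt (fun z => routhian P μ (x z) (y z))
      (reducedMomentum P (x τ) (y τ) ⬝ᵥ (y' ⨯₃ x τ + y τ ⨯₃ x')
        + reducedForce P μ (x τ) (y τ) ⬝ᵥ x') s τ := by
  have hk := (dot_J_pos P h).ne'
  have hJ := hasDerivWithinAt_mulVec P.J hx
  have hw := hasDerivWithinAt_cross hy hx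
  have hb := hasDerivWithinAt_bCoeff P hx hy h
  have hn := hasDerivWithinAt_nuCoeff P μ hx h
  have hk' := hasDerivWithinAt_dot hx hJ
  refine ((((hasDerivWithinAt_dot hw (hasDerivWithinAt_mulVec P.J hw)).const_mul (1 / 2)).sub
    ((((hb.pow 2).add (hn.pow 2)).const_mul (1 / 2)).mul hk')).add
    ((hasDerivWithinAt_dot hx (hasDerivWithinAt_const τ s P.ρ)).const_mul (P.m * P.g))).congr_deriv ?_
  have e1 := dot_J_comm P (y τ ⨯₃ x τ) (y' ⨯₃ x τ + y τ ⨯₃ x')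
  have e2 := dotProduct_comm (y' ⨯₃ x τ + y τ ⨯₃ x') (P.J *ᵥ (y τ ⨯₃ x τ))
  have e3 := dot_J_comm P (x τ) x'
  have e4 := dotProduct_comm x' (P.J *ᵥ x τ)
  have e5 : (P.J *ᵥ x') ⬝ᵥ (y τ ⨯₃ x τ) = (P.J *ᵥ (y τ ⨯₃ x τ)) ⬝ᵥ x' := by
    rw [← dot_J_comm, dotProduct_comm]
  have e6 : x' ⬝ᵥ P.ρ = P.ρ ⬝ᵥ x' := dotProduct_comm _ _
  simp only [reducedForce, reducedMomentum, sub_dotProduct, add_dotProduct, smul_dotProduct,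
    smul_eq_mul, Pi.add_apply, Pi.pow_apply, dotProduct_zero, e1, e2, e3, e4, e5, e6]
  generalize bCoeff P (x τ) (y τ) = b
  generalize nuCoeff P μ (x τ) = ν
  field_simp
  ring

/-! ### The variational equation as a pointwise equation -/

section Curves

variable {T : ℝ} {Γ : ℝ → V3}

lemma IsSphereCurve.contDiffOn_velocity (hT : 0 < T) (hΓ : IsSphereCurve T Γ) :
    ContDiffOn ℝ 1 (velocity T Γ) (Icc 0 T) :=
  hΓ.1.derivWithin (uniqueDiffOn_Icc hT) (by norm_num)

lemma hasDerivWithinAt_velocity {n : WithTop ℕ∞} (hn : n ≠ 0) {f : ℝ → V3}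
    (hf : ContDiffOn ℝ n f (Icc 0 T)) {t : ℝ} (ht : t ∈ Icc 0 T) :
    HasDerivWithinAt f (velocity T f t) (Icc 0 T) t :=
  ((hf.differentiableOn hn) t ht).hasDerivWithinAt

lemma hasDerivWithinAt_unique (hT : 0 < T) {E : Type*} [NormedAddCommGroup E] [NormedSpace ℝ E]
    {f : ℝ → E} {a b : E} {t : ℝ} (ht : t ∈ Icc 0 T)
    (ha : HasDerivWithinAt f a (Icc 0 T) t) (hb : HasDerivWithinAt f b (Icc 0 T) t) : a = b :=
  (uniqueDiffOn_Icc hT t ht).eq_deriv _ ha hb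

lemma dot_velocity_eq_zero (hT : 0 < T) {n : WithTop ℕ∞} (hn : n ≠ 0) {f : ℝ → V3}
    (hf : ContDiffOn ℝ n f (Icc 0 T)) (h1 : ∀ t ∈ Icc 0 T, f t ⬝ᵥ f t = 1) {t : ℝ}
    (ht : t ∈ Icc 0 T) : f t ⬝ᵥ velocity T f t = 0 := by
  have hd := hasDerivWithinAt_velocity hn hf ht
  have h := hasDerivWithinAt_unique hT ht (hasDerivWithinAt_dot hd hd)
    ((hasDerivWithinAt_const t (Icc 0 T) (1 : ℝ)).congr h1 (h1 t ht))
  rw [dotProduct_comm (velocity T f t)] at h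
  linarith

/-- The curve `p(t)` of reduced momenta along `Γ`. -/
noncomputable def momentumCurve (T : ℝ) (Γ : ℝ → V3) (t : ℝ) : V3 :=
  reducedMomentum P (Γ t) (velocity T Γ t)

/-- The defect of the reduced momentum equation `ṗ = q × Γ - (p · Γ̇) Γ - c Γ̇`. -/
noncomputable def residual (T : ℝ) (Γ : ℝ → V3) (t : ℝ) : V3 :=
  reducedForce P μ (Γ t) (velocity T Γ t) ⨯₃ Γ t
    - (momentumCurve P T Γ t ⬝ᵥ velocity T Γ t) • Γ t - cCoeff P μ (Γ t) • velocity T Γ t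
    - velocity T (momentumCurve P T Γ) t

lemma contDiffOn_momentumCurve (hT : 0 < T) (hΓ : IsSphereCurve T Γ) :
    ContDiffOn ℝ 1 (momentumCurve P T Γ) (Icc 0 T) :=
  contDiffOn_reducedMomentum P (hΓ.1.of_le one_le_two) (hΓ.contDiffOn_velocity hT) hΓ.2

lemma continuousOn_velocity_momentumCurve (hT : 0 < T) (hΓ : IsSphereCurve T Γ) :
    ContinuousOn (velocity T (momentumCurve P T Γ)) (Icc 0 T) :=
  (contDiffOn_momentumCurve P hT hΓ).continuousOn_derivWithin (uniqueDiffOn_Icc hT) le_rfl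

lemma continuousOn_residual (hT : 0 < T) (hΓ : IsSphereCurve T Γ) :
    ContinuousOn (residual P μ T Γ) (Icc 0 T) := by
  have h1 := hΓ.1.of_le one_le_two
  have hV := hΓ.contDiffOn_velocity hT
  have hp := (contDiffOn_momentumCurve P hT hΓ).continuousOn
  exact (((continuousOn_cross (contDiffOn_reducedForce P μ h1 hV hΓ.2).continuousOn
    h1.continuousOn).sub ((continuousOn_dot hp hV.continuousOn).smul h1.continuousOn)).sub
    ((contDiffOn_cCoeff P μ h1 hΓ.2).continuousOn.smul hV.continuousOn)).sub
    (continuousOn_velocity_momentumCurve P hT hΓ)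

/-- Differentiating `Γ · p = 0`. -/
lemma dot_velocity_momentumCurve (hT : 0 < T) (hΓ : IsSphereCurve T Γ) {t : ℝ}
    (ht : t ∈ Icc 0 T) :
    Γ t ⬝ᵥ velocity T (momentumCurve P T Γ) t = -(momentumCurve P T Γ t ⬝ᵥ velocity T Γ t) := by
  have hz : ∀ s ∈ Icc 0 T, Γ s ⬝ᵥ momentumCurve P T Γ s = 0 := fun s hs =>
    dot_reducedMomentum P (hΓ.2 s hs) _
  have h := hasDerivWithinAt_unique hT ht (hasDerivWithinAt_dot
    (hasDerivWithinAt_velocity two_ne_zero hΓ.1 ht)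
    (hasDerivWithinAt_velocity one_ne_zero (contDiffOn_momentumCurve P hT hΓ) ht))
    ((hasDerivWithinAt_const t (Icc 0 T) (0 : ℝ)).congr hz (hz t ht))
  rw [dotProduct_comm (velocity T Γ t)] at h
  linarith

lemma residual_dot (hT : 0 < T) (hΓ : IsSphereCurve T Γ) {t : ℝ} (ht : t ∈ Icc 0 T) :
    residual P μ T Γ t ⬝ᵥ Γ t = 0 := by
  have h1 := dot_velocity_momentumCurve P hT hΓ ht
  have h2 := dot_velocity_eq_zero hT two_ne_zero hΓ.1 hΓ.2 ht
  rw [residual, dotProduct_comm]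
  simp only [dotProduct_sub, dotProduct_smul, smul_eq_mul, dot_cross_self, h1, h2, hΓ.2 t ht]
  ring

/-- Three vectors of a plane are linearly dependent. -/
lemma triple_product_eq_zero {n x y z : V3} (hn : n ⬝ᵥ n = 1) (hx : n ⬝ᵥ x = 0) (hy : n ⬝ᵥ y = 0)
    (hz : n ⬝ᵥ z = 0) : x ⬝ᵥ (y ⨯₃ z) = 0 := by
  have h1 : n ⨯₃ (y ⨯₃ z) = 0 := by
    rw [cross_cross_eq_smul_sub_smul', hz, dotProduct_comm y, hy, zero_smul, zero_smul, sub_zero]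
  have h2 := cross_cross_eq_smul_sub_smul' n n (y ⨯₃ z)
  rw [h1, map_zero, hn, one_smul, eq_comm, sub_eq_zero] at h2
  rw [← h2, dotProduct_smul, dotProduct_comm x, hx, smul_zero]

/-- The pointwise identity behind the integration by parts: the derivative of the Routhian in the
direction `(δ, δ')` differs from the magnetic term and the pairing with the residual by the
derivative of `δ · (Γ × p)`. -/
lemma first_variation_identity {n V p p' q δ δ' : V3} {c : ℝ} (hn : n ⬝ᵥ n = 1)
    (hV : n ⬝ᵥ V = 0) (hp : n ⬝ᵥ p = 0) (hδ : n ⬝ᵥ δ = 0) :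
    p ⬝ᵥ (δ' ⨯₃ n + V ⨯₃ δ) + q ⬝ᵥ δ =
      c * (n ⬝ᵥ (V ⨯₃ δ)) + (q ⨯₃ n - (p ⬝ᵥ V) • n - c • V - p') ⬝ᵥ (δ ⨯₃ n)
        + (δ' ⬝ᵥ (n ⨯₃ p) + δ ⬝ᵥ (V ⨯₃ p + n ⨯₃ p')) := by
  have h0 : δ ⬝ᵥ (V ⨯₃ p) = 0 := triple_product_eq_zero hn hδ hV hp
  have h0' : p ⬝ᵥ (V ⨯₃ δ) = 0 := triple_product_eq_zero hn hp hV hδ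
  have h1 : p ⬝ᵥ (δ' ⨯₃ n) = δ' ⬝ᵥ (n ⨯₃ p) := triple_product_permutation _ _ _
  have h2 : p' ⬝ᵥ (δ ⨯₃ n) = δ ⬝ᵥ (n ⨯₃ p') := triple_product_permutation _ _ _
  have h3 : V ⬝ᵥ (δ ⨯₃ n) = n ⬝ᵥ (V ⨯₃ δ) := (triple_product_permutation _ _ _).symm
  have h4 : n ⬝ᵥ (δ ⨯₃ n) = 0 := dot_cross_self _ _
  have h5 : n ⬝ᵥ δ = δ ⬝ᵥ n := dotProduct_comm _ _
  simp only [dotProduct_add, sub_dotProduct, smul_dotProduct, smul_eq_mul, cross_dot_cross, h0,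
    h0', h1, h2, h3, h4, hn, hδ]
  ring

lemma IsVariation.dot_deriv (hT : 0 < T) {G : ℝ → ℝ → V3} (hG : IsVariation T Γ G) {t : ℝ}
    (ht : t ∈ Icc 0 T) : Γ t ⬝ᵥ deriv (fun ε => G ε t) 0 = 0 := by
  obtain ⟨δ, δ', -, hδ⟩ := exists_variation_field hT hG.contDiffOn
  have hd : HasDerivAt (fun ε => G ε t) (δ t) 0 := (hδ t ht).1
  rw [hd.deriv]
  have h := hasDerivWithinAt_dot (hd.hasDerivWithinAt (s := univ)) hd.hasDerivWithinAt
  simp only [hG.unit _ t ht, hG.base t ht] at h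
  have h' := (uniqueDiffWithinAt_univ (𝕜 := ℝ) (x := (0 : ℝ))).eq_deriv _ h
    (hasDerivWithinAt_const _ _ _)
  rw [dotProduct_comm (δ t)] at h'
  linarith

/-- The first variation formula: integration by parts against the momentum `Γ × p` leaves the magnetic
term and the pairing with the residual. -/
lemma hasDerivAt_integral_routhian (hT : 0 < T) (hΓ : IsSphereCurve T Γ) {G : ℝ → ℝ → V3}
    (hG : IsVariation T Γ G) :
    HasDerivAt (fun ε => ∫ t in (0 : ℝ)..T, routhian P μ (G ε t) (velocity T (G ε) t))
      ((∫ t in (0 : ℝ)..T,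
          magneticForm P μ (Γ t) ![velocity T Γ t, deriv (fun ε => G ε t) 0])
        + ∫ t in (0 : ℝ)..T, residual P μ T Γ t ⬝ᵥ (deriv (fun ε => G ε t) 0 ⨯₃ Γ t)) 0 := by
  obtain ⟨δ, δ', hδ'c, hδ⟩ := exists_variation_field hT hG.contDiffOn
  have hv := contDiffOn_derivWithin_strip hT hG.contDiffOn
  have hA : ContDiffOn ℝ 1 (fun p : ℝ × ℝ => routhian P μ (G p.1 p.2) (velocity T (G p.1) p.2))
      (univ ×ˢ Icc 0 T) :=
    contDiffOn_routhian P μ (hG.contDiffOn.of_le one_le_two) hv fun p hp => hG.unit p.1 p.2 hp.2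
  have hvel : ∀ t ∈ Icc 0 T, velocity T (G 0) t = velocity T Γ t := fun t ht =>
    derivWithin_congr hG.base (hG.base t ht)
  have hδ0 : ∀ t ∈ Icc 0 T, deriv (fun ε => G ε t) 0 = δ t := fun t ht => (hδ t ht).1.deriv
  have hδΓ : ∀ t ∈ Icc 0 T, Γ t ⬝ᵥ δ t = 0 := fun t ht => by
    rw [← hδ0 t ht, hG.dot_deriv hT ht]
  -- The end points are fixed, so the boundary term of the integration by parts vanishes.
  have hend : ∀ t ∈ Icc 0 T, (∀ ε, G ε t = Γ t) → δ t = 0 := by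
    intro t ht h
    rw [← hδ0 t ht, funext h, deriv_const]
  have hδ00 := hend 0 ⟨le_rfl, hT.le⟩ hG.left
  have hδT := hend T ⟨hT.le, le_rfl⟩ hG.right
  refine (hasDerivAt_integral_of_contDiffOn_strip hT hA).congr_deriv ?_
  set p := momentumCurve P T Γ with hp
  have hdp : ∀ t ∈ Icc 0 T, HasDerivWithinAt p (velocity T p t) (Icc 0 T) t := fun t ht =>
    hasDerivWithinAt_velocity one_ne_zero (contDiffOn_momentumCurve P hT hΓ) ht
  have hdΓ : ∀ t ∈ Icc 0 T, HasDerivWithinAt Γ (velocity T Γ t) (Icc 0 T) t := fun t ht =>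
    hasDerivWithinAt_velocity two_ne_zero hΓ.1 ht
  have hdB : ∀ t ∈ Icc 0 T, HasDerivWithinAt (fun t => δ t ⬝ᵥ (Γ t ⨯₃ p t))
      (δ' t ⬝ᵥ (Γ t ⨯₃ p t) + δ t ⬝ᵥ (velocity T Γ t ⨯₃ p t + Γ t ⨯₃ velocity T p t))
      (Icc 0 T) t := fun t ht =>
    hasDerivWithinAt_dot (hδ t ht).2.1 (hasDerivWithinAt_cross (hdΓ t ht) (hdp t ht))
  have hcΓ := hΓ.1.continuousOn
  have hcV := (hΓ.contDiffOn_velocity hT).continuousOn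
  have hcp := (contDiffOn_momentumCurve P hT hΓ).continuousOn
  have hcp' := continuousOn_velocity_momentumCurve P hT hΓ
  have hcδ : ContinuousOn δ (Icc 0 T) := fun t ht => (hδ t ht).2.1.continuousWithinAt
  have hcc := (contDiffOn_cCoeff P μ (hΓ.1.of_le one_le_two) hΓ.2).continuousOn
  have hii : ∀ {f : ℝ → ℝ}, ContinuousOn f (Icc 0 T) → IntervalIntegrable f volume 0 T :=
    fun h => ContinuousOn.intervalIntegrable (by rwa [uIcc_of_le hT.le])
  have iB : IntervalIntegrable (fun t => δ' t ⬝ᵥ (Γ t ⨯₃ p t)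
      + δ t ⬝ᵥ (velocity T Γ t ⨯₃ p t + Γ t ⨯₃ velocity T p t)) volume 0 T :=
    hii ((continuousOn_dot hδ'c (continuousOn_cross hcΓ hcp)).add
      (continuousOn_dot hcδ ((continuousOn_cross hcV hcp).add (continuousOn_cross hcΓ hcp'))))
  have iM : IntervalIntegrable (fun t => cCoeff P μ (Γ t) * (Γ t ⬝ᵥ (velocity T Γ t ⨯₃ δ t)))
      volume 0 T := hii (hcc.mul (continuousOn_dot hcΓ (continuousOn_cross hcV hcδ)))
  have iN : IntervalIntegrable (fun t => residual P μ T Γ t ⬝ᵥ (δ t ⨯₃ Γ t)) volume 0 T := hii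
    (continuousOn_dot (continuousOn_residual P μ hT hΓ) (continuousOn_cross hcδ hcΓ))
  have hB0 := intervalIntegral.integral_eq_sub_of_hasDerivAt_of_le hT.le
    (fun t ht => (hdB t ht).continuousWithinAt)
    (fun t ht => (hdB t (Ioo_subset_Icc_self ht)).hasDerivAt (Icc_mem_nhds ht.1 ht.2)) iB
  rw [hδ00, hδT, zero_dotProduct, zero_dotProduct, sub_zero] at hB0
  have hM : ∫ t in (0 : ℝ)..T,
        magneticForm P μ (Γ t) ![velocity T Γ t, deriv (fun ε => G ε t) 0] =
      ∫ t in (0 : ℝ)..T, cCoeff P μ (Γ t) * (Γ t ⬝ᵥ (velocity T Γ t ⨯₃ δ t)) := by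
    refine intervalIntegral.integral_congr fun t ht => ?_
    rw [uIcc_of_le hT.le] at ht
    rw [magneticForm_apply, hδ0 t ht]
  have hN : ∫ t in (0 : ℝ)..T, residual P μ T Γ t ⬝ᵥ (deriv (fun ε => G ε t) 0 ⨯₃ Γ t) =
      ∫ t in (0 : ℝ)..T, residual P μ T Γ t ⬝ᵥ (δ t ⨯₃ Γ t) := by
    refine intervalIntegral.integral_congr fun t ht => ?_
    rw [uIcc_of_le hT.le] at ht
    rw [hδ0 t ht]
  refine Eq.trans ?_ ((congrArg (_ + ·) hB0).trans (add_zero _))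
  rw [hM, hN, ← intervalIntegral.integral_add iM iN,
    ← intervalIntegral.integral_add (iM.add iN) iB]
  refine intervalIntegral.integral_congr fun t ht => ?_
  rw [uIcc_of_le hT.le] at ht
  have h := hasDerivWithinAt_routhian P μ ((hδ t ht).1.hasDerivWithinAt (s := univ))
    ((hδ t ht).2.2.hasDerivWithinAt (s := univ)) (hG.unit 0 t ht)
  rw [hasDerivWithinAt_univ] at h
  refine h.deriv.trans ?_
  have hv0 : derivWithin (fun s => G 0 s) (Icc 0 T) t = velocity T Γ t := hvel t ht
  rw [hv0, hG.base t ht]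
  exact first_variation_identity (hΓ.2 t ht)
    (dot_velocity_eq_zero hT two_ne_zero hΓ.1 hΓ.2 ht) (dot_reducedMomentum P (hΓ.2 t ht) _)
    (hδΓ t ht)

lemma satisfiesVariationalEquation_iff_integral_eq_zero (hT : 0 < T) (hΓ : IsSphereCurve T Γ)
    {F : V3 → V3 → ℝ} {β : V3 → V3 [⋀^Fin 2]→ₗ[ℝ] ℝ} (hF : IsRouthian P μ F)
    (hβ : IsMagneticForm P μ β) :
    SatisfiesVariationalEquation F β T Γ ↔ ∀ G, IsVariation T Γ G →
      ∫ t in (0 : ℝ)..T, residual P μ T Γ t ⬝ᵥ (deriv (fun ε => G ε t) 0 ⨯₃ Γ t) = 0 := by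
  refine forall₂_congr fun G hG => ?_
  have h := hasDerivAt_integral_routhian P μ hT hΓ hG
  have e1 : (fun ε => ∫ t in (0 : ℝ)..T, F (G ε t) (velocity T (G ε) t)) =
      fun ε => ∫ t in (0 : ℝ)..T, routhian P μ (G ε t) (velocity T (G ε) t) := by
    funext ε
    refine intervalIntegral.integral_congr fun t ht => ?_
    rw [uIcc_of_le hT.le] at ht
    have hGε : ContDiffOn ℝ 2 (G ε) (Icc 0 T) :=
      hG.contDiffOn.comp (f := fun s : ℝ => (ε, s)) (by fun_prop) fun s hs => ⟨mem_univ _, hs⟩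
    exact hF.eq_routhian P μ (hG.unit ε t ht)
      (dot_velocity_eq_zero hT two_ne_zero hGε (hG.unit ε) ht)
  have e2 : ∫ t in (0 : ℝ)..T, β (Γ t) ![velocity T Γ t, deriv (fun ε => G ε t) 0] =
      ∫ t in (0 : ℝ)..T, magneticForm P μ (Γ t) ![velocity T Γ t, deriv (fun ε => G ε t) 0] := by
    refine intervalIntegral.integral_congr fun t ht => ?_
    rw [uIcc_of_le hT.le] at ht
    rw [magneticForm_apply, hβ.apply_tangent P μ (hΓ.2 t ht)
      (dot_velocity_eq_zero hT two_ne_zero hΓ.1 hΓ.2 ht) (hG.dot_deriv hT ht)]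
  rw [e1, e2]
  constructor
  · intro h'
    have := h.unique h'
    linarith
  · intro h0
    rwa [h0, add_zero] at h

/-- Rotating `Γ` about the fixed axis `u` by an angle proportional to `ε φ(t)`, with the rotation
replaced by the normalisation of `Γ + ε φ u × Γ`, gives a variation with `δΓ = φ u × Γ`. -/
lemma exists_isVariation (hΓ : IsSphereCurve T Γ) (u : V3) {φ : ℝ → ℝ} (hφ : ContDiff ℝ 2 φ)
    (h0 : φ 0 = 0) (hφT : φ T = 0) :
    ∃ G, IsVariation T Γ G ∧ ∀ t, deriv (fun ε => G ε t) 0 = φ t • (u ⨯₃ Γ t) := by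
  set m : ℝ → ℝ := fun t => φ t ^ 2 * ((u ⨯₃ Γ t) ⬝ᵥ (u ⨯₃ Γ t)) with hm
  have hm0 : ∀ t, 0 ≤ m t := fun t => mul_nonneg (sq_nonneg _) (by
    simpa using dotProduct_star_self_nonneg (u ⨯₃ Γ t))
  have hpos : ∀ ε t, 0 < 1 + ε ^ 2 * m t := fun ε t => by
    have := mul_nonneg (sq_nonneg ε) (hm0 t)
    linarith
  refine ⟨fun ε t => (√(1 + ε ^ 2 * m t))⁻¹ • (Γ t + (ε * φ t) • (u ⨯₃ Γ t)), ?_, ?_⟩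
  · refine ⟨?_, ?_, ?_, ?_, ?_⟩
    · have hΓ2 : ContDiffOn ℝ 2 (fun p : ℝ × ℝ => Γ p.2) (univ ×ˢ Icc 0 T) :=
        hΓ.1.comp contDiffOn_snd fun p hp => hp.2
      have hφ2 : ContDiffOn ℝ 2 (fun p : ℝ × ℝ => φ p.2) (univ ×ˢ Icc 0 T) :=
        (hφ.comp contDiff_snd).contDiffOn
      have hu : ContDiffOn ℝ 2 (fun p : ℝ × ℝ => u ⨯₃ Γ p.2) (univ ×ˢ Icc 0 T) :=
        contDiffOn_cross contDiffOn_const hΓ2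
      have hm2 : ContDiffOn ℝ 2 (fun p : ℝ × ℝ => 1 + p.1 ^ 2 * m p.2) (univ ×ˢ Icc 0 T) :=
        contDiffOn_const.add ((contDiffOn_fst.pow 2).mul ((hφ2.pow 2).mul (contDiffOn_dot hu hu)))
      exact ((hm2.sqrt fun p _ => (hpos p.1 p.2).ne').inv
        fun p _ => (Real.sqrt_pos.2 (hpos p.1 p.2)).ne').smul
          (hΓ2.add ((contDiffOn_fst.mul hφ2).smul hu))
    · intro ε t ht
      have hs : √(1 + ε ^ 2 * m t) ^ 2 = 1 + ε ^ 2 * m t := Real.sq_sqrt (hpos ε t).le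
      have hs0 : √(1 + ε ^ 2 * m t) ≠ 0 := (Real.sqrt_pos.2 (hpos ε t)).ne'
      have e : (Γ t + (ε * φ t) • (u ⨯₃ Γ t)) ⬝ᵥ (Γ t + (ε * φ t) • (u ⨯₃ Γ t)) =
          1 + ε ^ 2 * m t := by
        simp only [dotProduct_add, add_dotProduct, dotProduct_smul, smul_dotProduct, smul_eq_mul,
          hΓ.2 t ht, dot_cross_self, dotProduct_comm (u ⨯₃ Γ t) (Γ t), hm]
        ring
      rw [dotProduct_smul, smul_dotProduct, e, smul_eq_mul, smul_eq_mul]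
      generalize √(1 + ε ^ 2 * m t) = r at hs hs0
      rw [← hs]
      field_simp
    · intro t _
      simp
    · intro ε
      simp [hm, h0]
    · intro ε
      simp [hm, hφT]
  · intro t
    have h1 : HasDerivAt (fun ε : ℝ => 1 + ε ^ 2 * m t) 0 0 := by
      have := (((hasDerivAt_id (0 : ℝ)).pow 2).mul_const (m t)).const_add 1
      simpa using this
    have h2 := (h1.sqrt (hpos 0 t).ne').inv (Real.sqrt_pos.2 (hpos 0 t)).ne'
    have h3 : HasDerivAt (fun ε : ℝ => Γ t + (ε * φ t) • (u ⨯₃ Γ t)) (φ t • (u ⨯₃ Γ t)) 0 := by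
      have := (((hasDerivAt_id (0 : ℝ)).mul_const (φ t)).smul_const (u ⨯₃ Γ t)).const_add (Γ t)
      simpa using this
    have h4 := (h2.smul h3).deriv
    refine h4.trans ?_
    simp

/-- The variational equation holds if and only if the residual vanishes: the residual is tangent to
the sphere, and the variation fields `φ u × Γ` detect its component along `u`. -/
lemma satisfiesVariationalEquation_iff_residual (hT : 0 < T) (hΓ : IsSphereCurve T Γ)
    {F : V3 → V3 → ℝ} {β : V3 → V3 [⋀^Fin 2]→ₗ[ℝ] ℝ} (hF : IsRouthian P μ F)
    (hβ : IsMagneticForm P μ β) :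
    SatisfiesVariationalEquation F β T Γ ↔ ∀ t ∈ Icc 0 T, residual P μ T Γ t = 0 := by
  rw [satisfiesVariationalEquation_iff_integral_eq_zero P μ hT hΓ hF hβ]
  constructor
  · intro h
    have hu : ∀ u : V3, ∀ t ∈ Icc 0 T, residual P μ T Γ t ⬝ᵥ u = 0 := by
      intro u
      refine eqOn_zero_of_integral_smooth_mul_eq_zero hT
        (continuousOn_dot (continuousOn_residual P μ hT hΓ) continuousOn_const) ?_
      intro φ hφ h0 hφT
      obtain ⟨G, hG, hd⟩ := exists_isVariation hΓ u hφ h0 hφT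
      have hz := h G hG
      rw [← neg_eq_zero, ← intervalIntegral.integral_neg] at hz
      refine Eq.trans ?_ hz
      refine intervalIntegral.integral_congr fun t ht => ?_
      rw [uIcc_of_le hT.le] at ht
      simp only [hd, map_smul, LinearMap.smul_apply, dotProduct_smul, smul_eq_mul,
        cross_cross_eq_smul_sub_smul, dotProduct_sub, hΓ.2 t ht, residual_dot P μ hT hΓ ht]
      ring
    intro t ht
    ext i
    simpa using hu (Pi.single i 1) t ht
  · intro h G _
    refine (intervalIntegral.integral_congr (g := fun _ => (0 : ℝ)) fun t ht => ?_).trans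
      intervalIntegral.integral_zero
    rw [uIcc_of_le hT.le] at ht
    beta_reduce
    rw [h t ht, zero_dotProduct]

/-! ### The reduced equation of motion -/

/-- The bracket in the definition of `Σ`, in terms of the reduced force. -/
lemma reducedForce_cross {n V : V3} (h : n ⬝ᵥ n = 1) :
    reducedForce P μ n V ⨯₃ n - (reducedMomentum P n V ⬝ᵥ V) • n =
      reducedMomentum P n V ⨯₃ ((V ⨯₃ n) - bCoeff P n V • n)
        + (nuCoeff P μ n) ^ 2 • ((P.J *ᵥ n) ⨯₃ n) + (P.m * P.g) • (P.ρ ⨯₃ n) := by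
  have hp : reducedMomentum P n V ⬝ᵥ n = 0 := by
    rw [dotProduct_comm, dot_reducedMomentum P h]
  have h1 : reducedMomentum P n V ⨯₃ (V ⨯₃ n) = -(reducedMomentum P n V ⬝ᵥ V) • n := by
    rw [cross_cross_eq_smul_sub_smul', hp, zero_smul, dotProduct_comm V, zero_sub, neg_smul]
  rw [map_sub, h1, reducedForce]
  simp only [map_sub, map_add, map_smul, LinearMap.sub_apply, LinearMap.add_apply,
    LinearMap.smul_apply]
  module

lemma J_sigmaVec {n V : V3} (h : n ⬝ᵥ n = 1) :
    P.J *ᵥ sigmaVec P μ n V = bCoeff P n V • (P.J *ᵥ V) + (reducedForce P μ n V ⨯₃ n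
      - (reducedMomentum P n V ⬝ᵥ V) • n - cCoeff P μ n • V) := by
  rw [reducedForce_cross P μ h, sigmaVec, mulVec_add, mulVec_smul, J_mulVec_inv,
    ← cross_anticomm P.ρ n, smul_neg, sub_neg_eq_add]
  rfl

lemma residual_eq (hT : 0 < T) (hΓ : IsSphereCurve T Γ) {t : ℝ} (ht : t ∈ Icc 0 T) :
    ∃ b' : ℝ, residual P μ T Γ t = P.J *ᵥ (sigmaVec P μ (Γ t) (velocity T Γ t)
      - velocity T (velocity T Γ) t ⨯₃ Γ t + b' • Γ t) := by
  have hd := hasDerivWithinAt_velocity two_ne_zero hΓ.1 ht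
  have hd2 := hasDerivWithinAt_velocity one_ne_zero (hΓ.contDiffOn_velocity hT) ht
  have hJ := hasDerivWithinAt_mulVec P.J hd
  obtain ⟨b', hb⟩ : ∃ b', HasDerivWithinAt (fun s => bCoeff P (Γ s) (velocity T Γ s)) b'
      (Icc 0 T) t := ⟨_, hasDerivWithinAt_bCoeff P hd hd2 (hΓ.2 t ht)⟩
  have hp := hasDerivWithinAt_unique hT ht
    (hasDerivWithinAt_velocity one_ne_zero (contDiffOn_momentumCurve P hT hΓ) ht)
    ((hasDerivWithinAt_mulVec P.J (hasDerivWithinAt_cross hd2 hd)).sub (hb.smul hJ))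
  refine ⟨b', ?_⟩
  rw [mulVec_add, mulVec_sub, J_sigmaVec P μ (hΓ.2 t ht), residual, hp, cross_self, add_zero,
    mulVec_smul]
  rw [momentumCurve]
  module

/-- The residual vanishes if and only if the reduced equation of motion holds. The latter determines
`Γ̈ × Γ` only up to a multiple of `Γ`, which is fixed since the residual is orthogonal to `Γ`. -/
lemma residual_eq_zero_iff (hT : 0 < T) (hΓ : IsSphereCurve T Γ) {t : ℝ} (ht : t ∈ Icc 0 T) :
    residual P μ T Γ t = 0 ↔ velocity T (velocity T Γ) t =
      -(velocity T Γ t ⬝ᵥ velocity T Γ t) • Γ t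
        + Γ t ⨯₃ sigmaVec P μ (Γ t) (velocity T Γ t) := by
  obtain ⟨b', hb'⟩ := residual_eq P μ hT hΓ ht
  have h1 := hΓ.2 t ht
  constructor
  · intro h
    rw [h] at hb'
    have h0 := congrArg (fun x => Γ t ⨯₃ (P.J⁻¹ *ᵥ x)) hb'
    simp only [mulVec_zero, map_zero, J_inv_mulVec, map_add, map_sub, map_smul, cross_self,
      smul_zero, add_zero, cross_cross_eq_smul_sub_smul', h1, one_smul] at h0
    have hd := hasDerivWithinAt_unique hT ht (hasDerivWithinAt_dot
      (hasDerivWithinAt_velocity two_ne_zero hΓ.1 ht)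
      (hasDerivWithinAt_velocity one_ne_zero (hΓ.contDiffOn_velocity hT) ht))
      ((hasDerivWithinAt_const t (Icc 0 T) (0 : ℝ)).congr
        (fun s hs => dot_velocity_eq_zero hT two_ne_zero hΓ.1 hΓ.2 hs)
        (dot_velocity_eq_zero hT two_ne_zero hΓ.1 hΓ.2 ht))
    have hd' : velocity T (velocity T Γ) t ⬝ᵥ Γ t = -(velocity T Γ t ⬝ᵥ velocity T Γ t) := by
      rw [dotProduct_comm]; linarith
    rw [hd'] at h0
    rw [eq_comm, sub_eq_zero] at h0
    rw [h0]
    module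
  · intro h
    have h2 : velocity T (velocity T Γ) t ⨯₃ Γ t =
        sigmaVec P μ (Γ t) (velocity T Γ t)
          - (Γ t ⬝ᵥ sigmaVec P μ (Γ t) (velocity T Γ t)) • Γ t := by
      rw [h, map_add, LinearMap.add_apply, map_smul, LinearMap.smul_apply, cross_self, smul_zero,
        zero_add, cross_cross_unit h1]
    have h3 : residual P μ T Γ t =
        (Γ t ⬝ᵥ sigmaVec P μ (Γ t) (velocity T Γ t) + b') • (P.J *ᵥ Γ t) := by
      rw [hb', h2, ← mulVec_smul]
      congr 1
      module
    have h4 := residual_dot P μ hT hΓ ht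
    rw [h3, smul_dotProduct, smul_eq_mul, dotProduct_comm (P.J *ᵥ Γ t)] at h4
    rw [h3, (mul_eq_zero.1 h4).resolve_right (dot_J_pos P h1).ne', zero_smul]

end Curves

/-! ### Motions of the full system -/

section Motion

variable {T : ℝ} {R : ℝ → M3} {ω : ℝ → V3}

lemma IsMotion.hasDerivWithinAt_proj (h : IsMotion P T R ω) {t : ℝ} (ht : t ∈ Icc 0 T) :
    HasDerivWithinAt (fun s => proj (R s)) (proj (R t) ⨯₃ ω t) (Icc 0 T) t := by
  simp only [proj_eq]
  rw [hasDerivWithinAt_pi]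
  intro j
  convert! (h t ht).2.1 2 j using 1
  simp only [Matrix.mul_apply, Fin.sum_univ_three, cross_apply]
  fin_cases j <;> simp [hat] <;> ring

lemma IsMotion.hasDerivWithinAt_omega (h : IsMotion P T R ω) {t : ℝ} (ht : t ∈ Icc 0 T) :
    HasDerivWithinAt ω (P.J⁻¹ *ᵥ ((P.J *ᵥ ω t) ⨯₃ ω t + (P.m * P.g) • (P.ρ ⨯₃ proj (R t))))
      (Icc 0 T) t := by
  obtain ⟨-, -, ω', hω, he⟩ := h t ht
  rw [← he, J_inv_mulVec]
  exact hω

lemma contDiffOn_succ_of_hasDerivWithinAt (hT : 0 < T) {n : ℕ} {f f' : ℝ → V3}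
    (hf : ∀ t ∈ Icc 0 T, HasDerivWithinAt f (f' t) (Icc 0 T) t)
    (hf' : ContDiffOn ℝ n f' (Icc 0 T)) : ContDiffOn ℝ (n + 1) f (Icc 0 T) := by
  rw [contDiffOn_succ_iff_derivWithin (uniqueDiffOn_Icc hT)]
  refine ⟨fun t ht => (hf t ht).differentiableWithinAt, by simp, hf'.congr fun t ht => ?_⟩
  exact (hf t ht).derivWithin (uniqueDiffOn_Icc hT t ht)

lemma IsMotion.isSphereCurve (hT : 0 < T) (h : IsMotion P T R ω) :
    IsSphereCurve T (fun t => proj (R t)) := by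
  refine ⟨?_, fun t ht => proj_unit (h t ht).1⟩
  have hcΓ : ContinuousOn (fun t => proj (R t)) (Icc 0 T) := fun t ht =>
    (h.hasDerivWithinAt_proj P ht).continuousWithinAt
  have hcω : ContinuousOn ω (Icc 0 T) := fun t ht =>
    (h.hasDerivWithinAt_omega P ht).continuousWithinAt
  have hcρ : ContinuousOn (fun t => (P.m * P.g) • (P.ρ ⨯₃ proj (R t))) (Icc 0 T) :=
    ContinuousOn.const_smul (g := fun t => P.ρ ⨯₃ proj (R t))
      (continuousOn_cross continuousOn_const hcΓ) (P.m * P.g)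
  have hω : ContDiffOn ℝ 1 ω (Icc 0 T) := by
    refine contDiffOn_succ_of_hasDerivWithinAt (n := 0) hT
      (fun t ht => h.hasDerivWithinAt_omega P ht) (contDiffOn_zero.2 ?_)
    exact continuousOn_mulVec _ ((continuousOn_cross (continuousOn_mulVec _ hcω) hcω).add
      hcρ)
  have hΓ : ContDiffOn ℝ 1 (fun t => proj (R t)) (Icc 0 T) :=
    contDiffOn_succ_of_hasDerivWithinAt (n := 0) hT
      (fun t ht => h.hasDerivWithinAt_proj P ht) (contDiffOn_zero.2 (continuousOn_cross hcΓ hcω))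
  exact contDiffOn_succ_of_hasDerivWithinAt (n := 1) hT
    (fun t ht => h.hasDerivWithinAt_proj P ht) (contDiffOn_cross hΓ hω)

/-- Conservation of the vertical angular momentum. -/
lemma IsMotion.momentum_eq_const (h : IsMotion P T R ω) {t : ℝ} (ht : t ∈ Icc 0 T) :
    momentum P (R t) (ω t) = momentum P (R 0) (ω 0) := by
  have hd : ∀ s ∈ Icc 0 T,
      HasDerivWithinAt (fun s => momentum P (R s) (ω s)) 0 (Icc 0 T) s := by
    intro s hs
    obtain ⟨-, -, ω', hω, he⟩ := h s hs
    refine ((hasDerivWithinAt_dot (hasDerivWithinAt_mulVec P.J hω)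
      (h.hasDerivWithinAt_proj P hs)).congr_deriv ?_).congr (fun r hr => ?_) ?_
    · rw [he]
      generalize P.J *ᵥ ω s = a
      simp only [add_dotProduct, smul_dotProduct]
      rw [dotProduct_comm (P.ρ ⨯₃ _), dot_cross_self, dotProduct_comm (a ⨯₃ _),
        triple_product_permutation, ← cross_anticomm (proj (R s)) (ω s), dotProduct_neg]
      simp
    · rw [momentum_eq P (h r hr).1, dot_J_comm]
    · rw [momentum_eq P (h s hs).1, dot_J_comm]
  have hc := constant_of_has_deriv_right_zero (fun s hs => (hd s hs).continuousWithinAt)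
    (fun s hs => ((hd s (Ico_subset_Icc_self hs)).mono_of_mem_nhdsWithin
      (Icc_mem_nhdsGE_of_mem hs)))
  exact hc t ht

/-- The angular velocity splits into its horizontal part `Γ̇ × Γ - b Γ` and its vertical part
`ν Γ`. -/
lemma omega_eq {n w : V3} (hn : n ⬝ᵥ n = 1) (hμ : w ⬝ᵥ (P.J *ᵥ n) = μ) :
    w = ((n ⨯₃ w) ⨯₃ n - bCoeff P n (n ⨯₃ w) • n) + nuCoeff P μ n • n := by
  have hk := (dot_J_pos P hn).ne'
  have hb : bCoeff P n (n ⨯₃ w) = nuCoeff P μ n - n ⬝ᵥ w := by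
    rw [bCoeff, nuCoeff, cross_cross_unit hn, dotProduct_sub, dotProduct_smul,
      dotProduct_comm _ w, hμ, dotProduct_comm (P.J *ᵥ n), smul_eq_mul]
    field_simp
  rw [hb, cross_cross_unit hn]
  module

/-- The algebraic identity through which the full equation of motion implies the reduced one: the
gyroscopic terms linear in `ν` add up to the magnetic term. -/
lemma gyroscopic_identity {n u : V3} (hn : n ⬝ᵥ n = 1) (hu : (P.J *ᵥ n) ⬝ᵥ u = 0) :
    nuCoeff P μ n • ((P.J *ᵥ u) ⨯₃ n + (P.J *ᵥ n) ⨯₃ u) =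
      nuCoeff P μ n • (P.J *ᵥ (n ⨯₃ u)) - cCoeff P μ n • (n ⨯₃ u)
        + (-2 * nuCoeff P μ n * ((P.J *ᵥ n) ⬝ᵥ (n ⨯₃ u)) / (n ⬝ᵥ (P.J *ᵥ n))) • (P.J *ᵥ n) := by
  have hk := (dot_J_pos P hn).ne'
  have h1 : (P.J *ᵥ u) ⨯₃ n =
      -(P.J.trace • (n ⨯₃ u)) + P.J *ᵥ (n ⨯₃ u) + (P.J *ᵥ n) ⨯₃ u := by
    have h := J_cross_add_cross_J P u n
    rw [← cross_anticomm (P.J *ᵥ n) u, ← cross_anticomm n u, mulVec_neg, ← sub_eq_add_neg,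
      sub_eq_iff_eq_add] at h
    rw [h]
    module
  have h2 : (P.J *ᵥ n) ⨯₃ ((P.J *ᵥ n) ⨯₃ (n ⨯₃ u)) =
      -((n ⬝ᵥ (P.J *ᵥ n)) • ((P.J *ᵥ n) ⨯₃ u)) := by
    rw [cross_cross_eq_smul_sub_smul' (P.J *ᵥ n) n u, hu, zero_smul, zero_sub, map_neg, map_smul]
  rw [cross_cross_eq_smul_sub_smul'] at h2
  have h3 : (P.J *ᵥ n) ⨯₃ u = (n ⬝ᵥ (P.J *ᵥ n))⁻¹ •
      (((P.J *ᵥ n) ⬝ᵥ (P.J *ᵥ n)) • (n ⨯₃ u)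
        - ((P.J *ᵥ n) ⬝ᵥ (n ⨯₃ u)) • (P.J *ᵥ n)) := by
    rw [eq_inv_smul_iff₀ hk, ← neg_inj, ← h2]
    module
  rw [h1, h3, cCoeff]
  module

lemma IsMotion.residual_eq_zero (hT : 0 < T) (h : IsMotion P T R ω)
    (hμ : momentum P (R 0) (ω 0) = μ) {t : ℝ} (ht : t ∈ Icc 0 T) :
    residual P μ T (fun t => proj (R t)) t = 0 := by
  have hΓ := h.isSphereCurve P hT
  have hu := uniqueDiffOn_Icc hT
  have hV : ∀ s ∈ Icc 0 T, velocity T (fun t => proj (R t)) s = proj (R s) ⨯₃ ω s := fun s hs =>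
    (h.hasDerivWithinAt_proj P hs).derivWithin (hu s hs)
  have hm : ∀ s ∈ Icc 0 T, ω s ⬝ᵥ (P.J *ᵥ proj (R s)) = μ := fun s hs => by
    rw [← momentum_eq P (h s hs).1, h.momentum_eq_const P hs, hμ]
  have hpJ : ∀ s ∈ Icc 0 T, momentumCurve P T (fun t => proj (R t)) s =
      P.J *ᵥ ω s - nuCoeff P μ (proj (R s)) • (P.J *ᵥ proj (R s)) := by
    intro s hs
    have h1 := congrArg (P.J *ᵥ ·) (omega_eq P μ (proj_unit (h s hs).1) (hm s hs))
    simp only [mulVec_add, mulVec_sub, mulVec_smul] at h1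
    rw [momentumCurve, reducedMomentum, hV s hs]
    rw [h1]
    module
  obtain ⟨-, -, ω', hω, he⟩ := h t ht
  have hdΓ := h.hasDerivWithinAt_proj P ht
  have hn := proj_unit (h t ht).1
  have hp' := hasDerivWithinAt_unique hT ht
    (hasDerivWithinAt_velocity one_ne_zero (contDiffOn_momentumCurve P hT hΓ) ht)
    (((hasDerivWithinAt_mulVec P.J hω).sub
      ((hasDerivWithinAt_nuCoeff P μ hdΓ hn).smul (hasDerivWithinAt_mulVec P.J hdΓ))).congr
      hpJ (hpJ t ht))
  have hpt : reducedMomentum P (proj (R t)) (proj (R t) ⨯₃ ω t) =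
      P.J *ᵥ ω t - nuCoeff P μ (proj (R t)) • (P.J *ᵥ proj (R t)) := by
    rw [← hpJ t ht, momentumCurve, hV t ht]
  rw [residual, hp', he, momentumCurve, hV t ht, reducedForce_cross P μ hn]
  have hsplit := omega_eq P μ hn (hm t ht)
  set n := proj (R t)
  set u := (n ⨯₃ ω t) ⨯₃ n - bCoeff P n (n ⨯₃ ω t) • n with hudef
  set ν := nuCoeff P μ n with hν
  have hVu : n ⨯₃ ω t = n ⨯₃ u := by
    rw [hsplit, map_add, map_smul, cross_self, smul_zero, add_zero]
  have hJu : P.J *ᵥ ω t = P.J *ᵥ u + ν • (P.J *ᵥ n) := by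
    rw [hsplit, mulVec_add, mulVec_smul]
  have hau : (P.J *ᵥ n) ⬝ᵥ u = 0 := by
    have := dot_reducedMomentum P hn (n ⨯₃ ω t)
    rwa [hpt, hJu, add_sub_cancel_right, dot_J_comm] at this
  have hg := gyroscopic_identity P μ hn hau
  rw [← hν] at hg
  rw [hpt, hJu, add_sub_cancel_right, hVu]
  have hcross : (P.J *ᵥ u + ν • (P.J *ᵥ n)) ⨯₃ ω t = (P.J *ᵥ u) ⨯₃ u
      + ν • ((P.J *ᵥ u) ⨯₃ n + (P.J *ᵥ n) ⨯₃ u) + ν ^ 2 • ((P.J *ᵥ n) ⨯₃ n) := by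
    rw [hsplit]
    simp only [map_add, map_smul, LinearMap.add_apply, LinearMap.smul_apply]
    module
  rw [hcross, hg]
  module

end Motion

end Pendulum

theorem mainTheorem6 (P : Pendulum.Data) (μ : ℝ) :
    (∃ F, IsRouthian P μ F) ∧ (∃ β, IsMagneticForm P μ β) ∧
    ∀ (F : V3 → V3 → ℝ) (β : V3 → V3 [⋀^Fin 2]→ₗ[ℝ] ℝ),
      IsRouthian P μ F → IsMagneticForm P μ β →
      (∀ Γ Γ' : V3, Γ ⬝ᵥ Γ = 1 → Γ ⬝ᵥ Γ' = 0 →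
        F Γ Γ' =
          (1 / 2) * ((Γ' ⨯₃ Γ) ⬝ᵥ (P.J *ᵥ (Γ' ⨯₃ Γ)))
            - (1 / 2) * ((bCoeff P Γ Γ') ^ 2 + (nuCoeff P μ Γ) ^ 2) * (Γ ⬝ᵥ (P.J *ᵥ Γ))
            + P.m * P.g * (Γ ⬝ᵥ P.ρ)) ∧
      (∀ Γ η ζ : V3, Γ ⬝ᵥ Γ = 1 →
        β Γ ![Γ ⨯₃ η, Γ ⨯₃ ζ] =
          -(μ / (Γ ⬝ᵥ (P.J *ᵥ Γ)) ^ 2) *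
            (-(Γ ⬝ᵥ (P.J *ᵥ Γ)) * P.J.trace + 2 * ((P.J *ᵥ Γ) ⬝ᵥ (P.J *ᵥ Γ))) *
            (Γ ⬝ᵥ (η ⨯₃ ζ))) ∧
      (∀ T : ℝ, 0 < T → ∀ (R : ℝ → M3) (ω : ℝ → V3),
        IsMotion P T R ω → momentum P (R 0) (ω 0) = μ →
        IsSphereCurve T (fun t => proj (R t)) ∧
          SatisfiesVariationalEquation F β T (fun t => proj (R t))) ∧
      (∀ T : ℝ, 0 < T → ∀ Γ : ℝ → V3, IsSphereCurve T Γ →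
        (SatisfiesVariationalEquation F β T Γ ↔
          ∀ t ∈ Set.Icc 0 T,
            velocity T (velocity T Γ) t =
              -(velocity T Γ t ⬝ᵥ velocity T Γ t) • Γ t
                + Γ t ⨯₃ sigmaVec P μ (Γ t) (velocity T Γ t))) := by
  refine ⟨⟨_, isRouthian_routhian P μ⟩, ⟨_, isMagneticForm_magneticForm P μ⟩, ?_⟩
  intro F β hF hβ
  refine ⟨fun Γ Γ' h h' => hF.eq_routhian P μ h h', fun Γ η ζ h => ?_, ?_, ?_⟩
  · rw [hβ.apply_cross P μ h, cCoeff_eq P μ h]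
  · intro T hT R ω hm hμ
    have hΓ := hm.isSphereCurve P hT
    exact ⟨hΓ, (satisfiesVariationalEquation_iff_residual P μ hT hΓ hF hβ).2 fun t ht =>
      hm.residual_eq_zero P μ hT hμ ht⟩
  · intro T hT Γ hΓ
    rw [satisfiesVariationalEquation_iff_residual P μ hT hΓ hF hβ]
    exact forall₂_congr fun t ht => residual_eq_zero_iff P μ hT hΓ ht
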